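/- Let $\mathcal A\subseteq B(\mathcal H)$ be a von Neumann algebra on a complex Hilbert space and let $\tau:\mathcal A\to\mathcal A$ be a normal unital completely positive map. For a normal unital completely positive map $\sigma$ of $\mathcal A$ and a subgroup $G$ of the unit circle $\mathbb T$ put $$\mathcal P_G(\sigma)=\overline{\operatorname{span}}^{\,\|\cdot\|}\{x\in\mathcal A:\ \sigma(x)=\lambda x\text{ for some }\lambda\in G\},$$ with the norm, the unit and the involution of $\mathcal A$, and with the product $\circ=\circ_\sigma$ obtained from the minimal dilation $(\mathcal K,\mathcal B,\theta)$ of $\sigma$: here $\mathcal K\supseteq\mathcal H$ is a Hilbert space with projection $p$ onto $\mathcal H$, $\mathcal B\subseteq B(\mathcal K)$ is a von Neumann algebra with $p\mathcal Bp=\mathcal A\subseteq\mathcal B$, $\theta$ is a normal unital $*$-endomorphism of $\mathcal B$ with $\sigma^n(x)=p\,\theta^n(x)\,p$ for all $x\in\mathcal A$, $n\ge 0$, $\mathcal K$ is the closed span of the vectors $\theta^n(x_n)\cdots\theta(x_1)h$ ($n\ge 0$, $x_i\in\mathcal A$, $h\in\mathcal H$), and $\mathcal B$ is generated by the $\theta^n(x)$.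 The compression $T(z)=pzp$ is a bijection from $\mathcal P_G(\theta)$ onto $\mathcal P_G(\sigma)$, and $x\circ y=T\big(T^{-1}(x)\,T^{-1}(y)\big)$. Equivalently, $\circ$ is the continuous bilinear product with $$x\circ y=\operatorname*{s-lim}_{n\to\infty}(\lambda\mu)^{-n}\sigma^n(xy)\qquad\text{if }\sigma(x)=\lambda x,\ \sigma(y)=\mu y,\ \lambda,\mu\in G .$$ The $C^*$-algebra $\mathcal P(\sigma)=\mathcal P_{\mathbb T}(\sigma)$ is the peripheral Poisson boundary of $\sigma$, and $\mathcal P_{\{1\}}(\sigma)=\{x\in\mathcal A:\sigma(x)=x\}$ is its Poisson boundary. Suppose that the subgroup of $\mathbb T$ generated by the peripheral point spectrum $\{\lambda\in\mathbb T:\ \exists\, x\in\mathcal A\setminus\{0\},\ \tau(x)=\lambda x\}$ is finite. Then there is an integer $k\ge 1$ such that $$\mathcal P(\tau)=\{x\in\mathcal A:\tau^k(x)=x\}=\mathcal P_{\{1\}}(\tau^k),$$ and the products $\circ_\tau$ and $\circ_{\tau^k}$ coincide; that is, the peripheral Poisson boundary of $\tau$ and the Poisson boundary of $\tau^k$ are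 the same $C^*$-algebra. In particular, the peripheral Poisson boundary of $\tau$ is a von Neumann algebra (a $C^*$-algebra that has a Banach space predual). -/

import Mathlib

open Filter Topology

universe u

noncomputable section

/-! ### A concrete von Neumann algebra as an ordered C⋆-algebra -/

section Instances

variable {H : Type u} [NormedAddCommGroup H] [InnerProductSpace ℂ H] [CompleteSpace H]

instance VonNeumannAlgebra.instSMulMemClassComplex :
    SMulMemClass (VonNeumannAlgebra H) ℂ (H →L[ℂ] H) where
  smul_mem {S} c _ hx := S.toStarSubalgebra.smul_mem hx c

instance VonNeumannAlgebra.instIsClosedCoe (A : VonNeumannAlgebra H) :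
    IsClosed (A : Set (H →L[ℂ] H)) := by
  rw [← A.centralizer_centralizer]
  exact Set.isClosed_centralizer _

/-- The operator (Loewner) order, restricted to a von Neumann algebra `A`, is the order of the
C⋆-algebra `A`. -/
instance VonNeumannAlgebra.instStarOrderedRingCoe (A : VonNeumannAlgebra H) :
    StarOrderedRing A := by
  refine StarOrderedRing.of_nonneg_iff' (fun {x y} hxy z => ?_) (fun x => ⟨fun hx => ?_, ?_⟩)
  · exact Subtype.coe_le_coe.mp (by simpa using Subtype.coe_le_coe.mpr hxy)
  · have hx' : (0 : H →L[ℂ] H) ≤ (x : H →L[ℂ] H) := by simpa using Subtype.coe_le_coe.mpr hx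
    have hsa : IsSelfAdjoint x := Subtype.ext (by simpa using (IsSelfAdjoint.of_nonneg hx').star_eq)
    have hspec : SpectrumRestricts x ContinuousMap.realToNNReal := by
      rw [SpectrumRestricts.nnreal_iff]
      intro r hr
      have h1 : (r : ℂ) ∈ spectrum ℂ x := by
        simpa using (spectrum.algebraMap_mem_iff ℂ (R := ℝ) (a := x) (r := r)).mpr hr
      have hcl : IsClosed (A.toStarSubalgebra : Set (H →L[ℂ] H)) :=
        VonNeumannAlgebra.instIsClosedCoe A
      have h0 : spectrum ℂ x = spectrum ℂ (x : H →L[ℂ] H) :=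
        StarSubalgebra.spectrum_eq (S := A.toStarSubalgebra) (a := x)
      rw [h0] at h1
      have h2 : r ∈ spectrum ℝ (x : H →L[ℂ] H) :=
        (spectrum.algebraMap_mem_iff ℂ (R := ℝ)).mp (by simpa using h1)
      exact spectrum_nonneg_of_nonneg hx' h2
    obtain ⟨s, hs₁, _, hs₂⟩ := CFC.exists_sqrt_of_isSelfAdjoint_of_quasispectrumRestricts hsa hspec
    exact ⟨s, by rw [hs₁.star_eq, hs₂]⟩
  · rintro ⟨s, rfl⟩
    exact Subtype.coe_le_coe.mp (star_mul_self_nonneg (s : H →L[ℂ] H))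

end Instances

/-! ### Normal maps -/

/-- The ultraweak (`σ`-weak) topology of a von Neumann algebra `A` on `H`: the coarsest topology
that makes all functionals `x ↦ ∑ₙ ⟪ξₙ, x ηₙ⟫` continuous, where `ξ` and `η` run through the
square-summable sequences in `H`. -/
abbrev ultraweakTopology {H : Type u} [NormedAddCommGroup H] [InnerProductSpace ℂ H]
    [CompleteSpace H] (A : VonNeumannAlgebra H) : TopologicalSpace A :=
  ⨅ (ξ : lp (fun _ : ℕ => H) 2) (η : lp (fun _ : ℕ => H) 2),
    TopologicalSpace.induced
      (fun x : A => ∑' n, inner ℂ ((ξ : ℕ → H) n) ((x : H →L[ℂ] H) ((η : ℕ → H) n)))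
      inferInstance

/-- A map of a von Neumann algebra into itself is normal if it is ultraweakly continuous. -/
def IsNormalMap {H : Type u} [NormedAddCommGroup H] [InnerProductSpace ℂ H]
    [CompleteSpace H] {A : VonNeumannAlgebra H} (f : A → A) : Prop :=
  @Continuous A A (ultraweakTopology A) (ultraweakTopology A) f

/-! ### Peripheral eigenvectors -/

section Peripheral

variable {H : Type u} [NormedAddCommGroup H] [InnerProductSpace ℂ H] [CompleteSpace H]
  {A : VonNeumannAlgebra H}

/-- The peripheral point spectrum: the eigenvalues of modulus one. -/
def peripheralPointSpectrum (τ : Module.End ℂ A) : Set Circle :=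
  {z | τ.HasEigenvalue (z : ℂ)}

/-- `𝒫_G(τ)`, the norm closure of the span of the eigenvectors with eigenvalue in the subgroup `G`
of the circle. For `G = ⊤` it is the operator space `𝒫(τ)` underlying the peripheral Poisson
boundary, for `G = ⊥` that of the Poisson boundary. -/
def peripheralSpace (τ : Module.End ℂ A) (G : Subgroup Circle) : Submodule ℂ A :=
  (Submodule.span ℂ {x : A | ∃ z ∈ G, τ x = (z : ℂ) • x}).topologicalClosure

end Peripheral

/-! ### The minimal dilation -/

section Dilation

variable {H : Type u} [NormedAddCommGroup H] [InnerProductSpace ℂ H] [CompleteSpace H]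
  {K : Type u} [NormedAddCommGroup K] [InnerProductSpace ℂ K] [CompleteSpace K]

/-- The compression `z ↦ p z p`, where `H` sits in `K` through the isometry `V` and `p = V V⋆`;
operators on `p K` are read as operators on `H`. -/
def compress (V : H →ₗᵢ[ℂ] K) (z : K →L[ℂ] K) : H →L[ℂ] H :=
  ContinuousLinearMap.adjoint V.toContinuousLinearMap ∘L z ∘L V.toContinuousLinearMap

/-- An operator on `H`, extended by zero to the orthogonal complement of `H` in `K`. -/
def inflate (V : H →ₗᵢ[ℂ] K) (x : H →L[ℂ] H) : K →L[ℂ] K :=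
  V.toContinuousLinearMap ∘L x ∘L ContinuousLinearMap.adjoint V.toContinuousLinearMap

/-- The vector `θⁿ(xₙ) θⁿ⁻¹(xₙ₋₁) ⋯ θ(x₁) h` of `K`, where `j` is the inclusion of `A` in `B`. -/
def dilationWord {A : VonNeumannAlgebra H} {B : VonNeumannAlgebra K} (V : H →ₗᵢ[ℂ] K)
    (j : A → B) (θ : B →⋆ₐ[ℂ] B) (x : ℕ → A) (h : H) : ℕ → K
  | 0 => V h
  | n + 1 => ((θ^[n + 1] (j (x (n + 1))) : B) : K →L[ℂ] K) (dilationWord V j θ x h n)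

/-- `(K, B, θ)` is a minimal dilation of `τ : A → A`, where `K` contains `H` through the
isometry `V` and `p` is the projection of `K` onto `H`. -/
structure IsMinimalDilation {A : VonNeumannAlgebra H} (τ : Module.End ℂ A)
    (V : H →ₗᵢ[ℂ] K) (B : VonNeumannAlgebra K) (θ : B →⋆ₐ[ℂ] B) : Prop where
  /-- `A ⊆ p B p`, as a subset of `B` -/
  inflate_mem : ∀ x : A, inflate V (x : H →L[ℂ] H) ∈ B
  /-- `p B p ⊆ A` -/
  compress_mem : ∀ z : B, compress V (z : K →L[ℂ] K) ∈ A
  /-- `θ` is a normal unital `⋆`-endomorphism -/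
  normal : IsNormalMap θ
  /-- `τⁿ(x) = p θⁿ(x) p` -/
  dilation : ∀ (n : ℕ) (x : A),
    compress V ((θ^[n] ⟨inflate V (x : H →L[ℂ] H), inflate_mem x⟩ : B) : K →L[ℂ] K)
      = (((τ ^ n) x : A) : H →L[ℂ] H)
  /-- `K` is the closed span of the vectors `θⁿ(xₙ) ⋯ θ(x₁) h` -/
  minimal_space : (Submodule.span ℂ {v : K | ∃ (x : ℕ → A) (h : H) (n : ℕ),
    dilationWord V (fun a : A => (⟨inflate V (a : H →L[ℂ] H), inflate_mem a⟩ : B)) θ x h n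
      = v}).topologicalClosure = ⊤
  /-- `B` is the von Neumann algebra generated by the operators `θⁿ(x)` -/
  minimal_algebra : ∀ N : VonNeumannAlgebra K,
    (∀ (n : ℕ) (x : A),
      ((θ^[n] ⟨inflate V (x : H →L[ℂ] H), inflate_mem x⟩ : B) : K →L[ℂ] K) ∈ N) → B ≤ N

end Dilation

/-! ### The Poisson boundaries -/

/-- The C⋆-algebra `M`, with underlying operator space placed in `A` by `φ`, is the C⋆-algebra
`(𝒫_G(τ), ∘)`: norm, unit and involution are those of `A`, and the product is the compression of
the product of the lifts to the minimal dilation. For eigenvectors this product is a strong operator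
limit in terms of `τ` only; that determines the product, as it is bilinear and continuous.

For `G = ⊤` this is the peripheral Poisson boundary of `τ`, for `G = ⊥` it is the Poisson boundary
of `τ`, that is, the space of harmonic elements with the Choi-Effros product. -/
structure IsPoissonBoundary {H : Type u} [NormedAddCommGroup H] [InnerProductSpace ℂ H]
    [CompleteSpace H] {A : VonNeumannAlgebra H} (τ : Module.End ℂ A) (G : Subgroup Circle)
    {M : Type u} [CStarAlgebra M] (φ : M →ₗᵢ[ℂ] A) : Prop where
  range_eq : LinearMap.range φ.toLinearMap = peripheralSpace τ G
  map_one : φ 1 = 1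
  map_star : ∀ a, φ (star a) = star (φ a)
  /-- the compression of every minimal dilation `(K, B, θ)` maps `𝒫_G(θ)` bijectively to
  `𝒫_G(τ)` -/
  bijOn : ∀ (K : Type u) [NormedAddCommGroup K] [InnerProductSpace ℂ K] [CompleteSpace K]
    (V : H →ₗᵢ[ℂ] K) (B : VonNeumannAlgebra K) (θ : B →⋆ₐ[ℂ] B), IsMinimalDilation τ V B θ →
    Set.BijOn (fun z : B => compress V (z : K →L[ℂ] K))
      (peripheralSpace θ.toAlgHom.toLinearMap G : Set B)
      ((fun x : A => (x : H →L[ℂ] H)) '' (peripheralSpace τ G : Set A))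
  /-- `x ∘ y = T (T⁻¹ x · T⁻¹ y)` for the compression `T : 𝒫_G(θ) → 𝒫_G(τ)` -/
  map_mul : ∀ (K : Type u) [NormedAddCommGroup K] [InnerProductSpace ℂ K] [CompleteSpace K]
    (V : H →ₗᵢ[ℂ] K) (B : VonNeumannAlgebra K) (θ : B →⋆ₐ[ℂ] B), IsMinimalDilation τ V B θ →
    ∀ (a b : M), ∀ y ∈ peripheralSpace θ.toAlgHom.toLinearMap G,
      ∀ z ∈ peripheralSpace θ.toAlgHom.toLinearMap G,
      compress V (y : K →L[ℂ] K) = (φ a : H →L[ℂ] H) →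
      compress V (z : K →L[ℂ] K) = (φ b : H →L[ℂ] H) →
      (φ (a * b) : H →L[ℂ] H) = compress V ((y * z : B) : K →L[ℂ] K)
  /-- `x ∘ y = s-lim (c d)⁻ⁿ τⁿ(x y)` if `τ x = c x` and `τ y = d y` -/
  map_mul_eigenvectors : ∀ (a b : M), ∀ c ∈ G, ∀ d ∈ G,
    τ (φ a) = (c : ℂ) • φ a → τ (φ b) = (d : ℂ) • φ b → ∀ h : H,
    Tendsto (fun n : ℕ =>
        (((((c : ℂ) * (d : ℂ)) ^ n)⁻¹ • (τ ^ n) (φ a * φ b) : A) : H →L[ℂ] H) h)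
      atTop (𝓝 ((φ (a * b) : H →L[ℂ] H) h))

end

/-! Let `k` be the order of the finite group generated by the peripheral eigenvalues. Every such
eigenvalue `c` satisfies `c ^ k = 1`, so eigenvectors are fixed by `τ ^ k`. Conversely, averaging
the orbit of a fixed point of `τ ^ k` against the characters of `ℤ/k` splits it into eigenvectors of
`τ`. As the fixed space is norm closed, it is the whole peripheral space
(`peripheralSpace_eq_harmonicSubmodule`).

One C⋆-algebra then serves both boundaries: the fixed points of `σ = τ ^ k` with the Choi-Effros
product `s-lim σⁿ(x y)`. By the Schwarz inequality `σⁿ(x⋆ x)` increases, so the limit exists on the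
diagonal, and everywhere by polarization. The defect `x ∘ y - x y` is asymptotically null, even
after multiplication on the right, which gives associativity. Of complete positivity only the
Schwarz inequality is used.

To describe this product through `τ` itself, note that `τ` permutes the fixed points of `τ ^ k` with
finite order. Going once around the cycle forces equality in the Schwarz inequality, so `τ` is
multiplicative there (`harmonicRotation_harmonicMul`), and limits along `k n` become limits along
`n`.

In a minimal dilation the projections `θⁿ(p)` increase strongly to `1`. Hence a fixed point of `θᵏ`
is determined by its compression, a fixed point `x` of `τ ^ k` lifts to the weak limit of `θ^(k
n)(x)`, and compressed products are Choi-Effros products. Both boundary claims are instances of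
`isPoissonBoundary_incl`: exponent `k` for `τ`, exponent `1` for `τ ^ k`.

For the predual, the closed span of the vector functionals on the fixed points is used. Normality of
`σ` ensures that an operator representing a functional on this span is itself fixed
(`operator_harmonic`). -/

noncomputable section

/-! ### Weak operator convergence of sequences -/

section WeakConvergence

open scoped ComplexOrder

variable {H : Type u} [NormedAddCommGroup H] [InnerProductSpace ℂ H]

/-- Convergence of a sequence of operators in the weak operator topology. -/
def WeakTendsto (a : ℕ → H →L[ℂ] H) (b : H →L[ℂ] H) : Prop :=
  ∀ ξ η : H, Tendsto (fun n => inner ℂ ξ (a n η)) atTop (𝓝 (inner ℂ ξ (b η)))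

namespace WeakTendsto

variable {a a' : ℕ → H →L[ℂ] H} {b b' : H →L[ℂ] H}

lemma of_strong (h : ∀ η, Tendsto (fun n => a n η) atTop (𝓝 (b η))) : WeakTendsto a b :=
  fun _ η => tendsto_const_nhds.inner (h η)

lemma const (b : H →L[ℂ] H) : WeakTendsto (fun _ => b) b := fun _ _ => tendsto_const_nhds

lemma add (h : WeakTendsto a b) (h' : WeakTendsto a' b') :
    WeakTendsto (fun n => a n + a' n) (b + b') := fun ξ η => by
  simpa [inner_add_right] using (h ξ η).add (h' ξ η)

lemma sub (h : WeakTendsto a b) (h' : WeakTendsto a' b') :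
    WeakTendsto (fun n => a n - a' n) (b - b') := fun ξ η => by
  simpa [inner_sub_right] using (h ξ η).sub (h' ξ η)

lemma smul (c : ℂ) (h : WeakTendsto a b) : WeakTendsto (fun n => c • a n) (c • b) := fun ξ η => by
  simpa [inner_smul_right] using (h ξ η).const_mul c

lemma comp_tendsto (h : WeakTendsto a b) {f : ℕ → ℕ} (hf : Tendsto f atTop atTop) :
    WeakTendsto (fun n => a (f n)) b := fun ξ η => (h ξ η).comp hf

lemma unique (h : WeakTendsto a b) (h' : WeakTendsto a b') : b = b' := by
  ext η
  exact ext_inner_left ℂ fun ξ => tendsto_nhds_unique (h ξ η) (h' ξ η)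

lemma of_quadratic (h : ∀ ξ, Tendsto (fun n => inner ℂ ξ (a n ξ)) atTop (𝓝 (inner ℂ ξ (b ξ)))) :
    WeakTendsto a b := by
  have h' : ∀ ξ, Tendsto (fun n => inner ℂ (a n ξ) ξ) atTop (𝓝 (inner ℂ (b ξ) ξ)) := fun ξ => by
    simpa [Function.comp_def] using (Complex.continuous_conj.tendsto _).comp (h ξ)
  intro ξ η
  have key : Tendsto (fun n => inner ℂ (a n η) ξ) atTop (𝓝 (inner ℂ (b η) ξ)) := by
    have e : ∀ T : H →L[ℂ] H, inner ℂ (T η) ξ = _ := fun T => inner_map_polarization' T.toLinearMap η ξ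
    simp only [e]
    exact ((((h' _).sub (h' _)).sub ((h' _).const_mul _)).add ((h' _).const_mul _)).div_const _
  simpa [Function.comp_def] using (Complex.continuous_conj.tendsto _).comp key

lemma norm_le (h : WeakTendsto a b) {C : ℝ} (hC : 0 ≤ C) (ha : ∀ n, ‖a n‖ ≤ C) : ‖b‖ ≤ C := by
  refine ContinuousLinearMap.opNorm_le_bound _ hC fun η => ?_
  have h1 : ‖inner ℂ (b η) (b η)‖ ≤ ‖b η‖ * (C * ‖η‖) := by
    refine le_of_tendsto (h (b η) η).norm (Eventually.of_forall fun n => ?_)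
    refine (norm_inner_le_norm _ _).trans ?_
    gcongr
    exact ((a n).le_opNorm η).trans (by gcongr; exact ha n)
  rw [inner_self_eq_norm_sq_to_K, norm_pow, RCLike.norm_ofReal, abs_norm, sq] at h1
  rcases (norm_nonneg (b η)).eq_or_lt with h0 | h0
  · rw [← h0]; positivity
  · exact le_of_mul_le_mul_left h1 h0

variable [CompleteSpace H]

lemma star (h : WeakTendsto a b) : WeakTendsto (fun n => star (a n)) (star b) := fun ξ η => by
  have := (Complex.continuous_conj.tendsto _).comp (h η ξ)
  simpa [Function.comp_def, ContinuousLinearMap.star_eq_adjoint,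
    ContinuousLinearMap.adjoint_inner_right] using this

lemma mul_left (c : H →L[ℂ] H) (h : WeakTendsto a b) : WeakTendsto (fun n => c * a n) (c * b) :=
  fun ξ η => by
    have := h (ContinuousLinearMap.adjoint c ξ) η
    simpa [ContinuousLinearMap.adjoint_inner_left] using this

omit [CompleteSpace H] in
lemma mul_right (c : H →L[ℂ] H) (h : WeakTendsto a b) : WeakTendsto (fun n => a n * c) (b * c) :=
  fun ξ η => h ξ (c η)

omit [CompleteSpace H] in
lemma le_of_le (h : WeakTendsto a b) (h' : WeakTendsto a' b') (hle : ∀ n, a n ≤ a' n) :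
    b ≤ b' := by
  rw [ContinuousLinearMap.le_def, ContinuousLinearMap.isPositive_iff_complex]
  intro ξ
  have h1 := (h'.sub h) ξ ξ
  have h2 : Tendsto (fun n => inner ℂ ((a' n - a n) ξ) ξ) atTop (𝓝 (inner ℂ ((b' - b) ξ) ξ)) := by
    simpa [Function.comp_def, inner_sub_left, inner_sub_right] using
      (Complex.continuous_conj.tendsto _).comp h1
  have h3 : ∀ n, _ := fun n =>
    (ContinuousLinearMap.isPositive_iff_complex _).1 ((ContinuousLinearMap.le_def _ _).1 (hle n)) ξ
  have h4 : Tendsto (fun n => RCLike.re (inner ℂ ((a' n - a n) ξ) ξ)) atTop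
      (𝓝 (RCLike.re (inner ℂ ((b' - b) ξ) ξ))) := (RCLike.continuous_re.tendsto _).comp h2
  refine ⟨tendsto_nhds_unique (((RCLike.continuous_ofReal (K := ℂ)).tendsto _).comp h4) ?_,
    ge_of_tendsto h4 (Eventually.of_forall fun n => (h3 n).2)⟩
  refine h2.congr fun n => (h3 n).1.symm

/-- Commutation with a fixed operator survives weak limits, and `A` is its own double commutant. -/
lemma mem (A : VonNeumannAlgebra H) (h : WeakTendsto a b) (ha : ∀ n, a n ∈ A) : b ∈ A := by
  rw [← A.commutant_commutant, VonNeumannAlgebra.mem_commutant_iff]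
  intro g hg
  have hg' := VonNeumannAlgebra.mem_commutant_iff.1 hg
  refine (h.mul_left g).unique ?_
  have := h.mul_right g
  simpa only [fun n => hg' (a n) (ha n)] using this

end WeakTendsto

lemma norm_apply_sq_eq_inner [CompleteSpace H] (a : H →L[ℂ] H) (ξ : H) :
    ((‖a ξ‖ ^ 2 : ℝ) : ℂ) = inner ℂ ξ ((star a * a) ξ) := by
  simp [ContinuousLinearMap.star_eq_adjoint, ContinuousLinearMap.adjoint_inner_right,
    inner_self_eq_norm_sq_to_K]

lemma norm_inner_le_of_le [CompleteSpace H] {a b : H →L[ℂ] H} (h0 : 0 ≤ a) (hab : a ≤ b) (ξ : H) :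
    ‖inner ℂ ξ (a ξ)‖ ≤ ‖inner ℂ ξ (b ξ)‖ := by
  have h1 : 0 ≤ inner ℂ ξ (a ξ) :=
    ((ContinuousLinearMap.nonneg_iff_isPositive _).1 h0).inner_nonneg_right ξ
  have h2 : 0 ≤ inner ℂ ξ ((b - a) ξ) :=
    ((ContinuousLinearMap.le_def _ _).1 hab).inner_nonneg_right ξ
  rw [sub_apply, inner_sub_right, sub_nonneg] at h2
  exact CStarAlgebra.norm_le_norm_of_nonneg_of_le h1 h2

lemma WeakTendsto.zero_of_le [CompleteSpace H] {a b : ℕ → H →L[ℂ] H} (h0 : ∀ n, 0 ≤ a n)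
    (hab : ∀ n, a n ≤ b n) (hb : WeakTendsto b 0) : WeakTendsto a 0 := by
  refine WeakTendsto.of_quadratic fun ξ => ?_
  have := hb ξ ξ
  simp only [zero_apply, inner_zero_right] at this ⊢
  exact squeeze_zero_norm (fun n => norm_inner_le_of_le (h0 n) (hab n) ξ)
    (by simpa using this.norm)

/-- If `a⋆ a` tends to zero weakly, then `a` tends to zero strongly. -/
lemma tendsto_zero_of_weakTendsto_star_mul [CompleteSpace H] {a : ℕ → H →L[ℂ] H}
    (h : WeakTendsto (fun n => star (a n) * a n) 0) (ξ : H) :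
    Tendsto (fun n => a n ξ) atTop (𝓝 0) := by
  have h1 : Tendsto (fun n => ‖a n ξ‖ ^ 2) atTop (𝓝 0) := by
    have := h ξ ξ
    simp only [← norm_apply_sq_eq_inner] at this
    have h2 := (Complex.continuous_re.tendsto _).comp this
    simpa only [Function.comp_def, Complex.ofReal_re, zero_apply, inner_zero_right,
      Complex.zero_re] using h2
  rw [tendsto_zero_iff_norm_tendsto_zero]
  simpa [Function.comp_def, Real.sqrt_sq] using (Real.continuous_sqrt.tendsto _).comp h1

/-- For a positive operator, `a² ≤ ‖a‖ a`. -/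
lemma norm_apply_sq_le_of_nonneg [CompleteSpace H] {a : H →L[ℂ] H} (h0 : 0 ≤ a) (ξ : H) :
    ‖a ξ‖ ^ 2 ≤ ‖a‖ * ‖inner ℂ ξ (a ξ)‖ := by
  obtain ⟨s, rfl⟩ := CStarAlgebra.nonneg_iff_eq_star_mul_self.1 h0
  have h1 : ‖inner ℂ ξ ((star s * s) ξ)‖ = ‖s ξ‖ ^ 2 := by
    rw [← norm_apply_sq_eq_inner, Complex.norm_real, Real.norm_eq_abs, abs_of_nonneg (by positivity)]
  rw [h1, CStarRing.norm_star_mul_self]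
  have h2 : ‖(star s * s) ξ‖ ≤ ‖s‖ * ‖s ξ‖ := by
    simpa using (star s).le_opNorm (s ξ)
  calc _ ≤ (‖s‖ * ‖s ξ‖) ^ 2 := by gcongr
    _ = _ := by ring

/-- A bounded increasing sequence of operators converges strongly. -/
lemma exists_strong_limit_of_monotone [CompleteSpace H] {a : ℕ → H →L[ℂ] H} (hmono : Monotone a)
    {C : ℝ} (hC : ∀ n, ‖a n‖ ≤ C) :
    ∃ b : H →L[ℂ] H, ∀ ξ, Tendsto (fun n => a n ξ) atTop (𝓝 (b ξ)) := by
  have hq : ∀ ξ, CauchySeq fun n => (inner ℂ ξ ((a n) ξ)).re := fun ξ => by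
    have hm : Monotone fun n => (inner ℂ ξ ((a n) ξ)).re := fun m n hmn => by
      have h2 : 0 ≤ inner ℂ ξ ((a n - a m) ξ) :=
        ((ContinuousLinearMap.le_def _ _).1 (hmono hmn)).inner_nonneg_right ξ
      rw [sub_apply, inner_sub_right, sub_nonneg] at h2
      exact (Complex.le_def.1 h2).1
    have hb : BddAbove (Set.range fun n => (inner ℂ ξ ((a n) ξ)).re) := by
      refine ⟨‖ξ‖ * (C * ‖ξ‖), ?_⟩
      rintro _ ⟨n, rfl⟩
      refine (Complex.re_le_norm _).trans ((norm_inner_le_norm _ _).trans ?_)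
      gcongr
      exact ((a n).le_opNorm ξ).trans (by gcongr; exact hC n)
    exact (tendsto_atTop_ciSup hm hb).cauchySeq
  have hc : ∀ ξ, CauchySeq fun n => a n ξ := fun ξ => by
    -- The increment is positive of norm at most `2 C`, so `norm_apply_sq_le_of_nonneg` reduces
    -- strong Cauchyness to that of the quadratic forms.
    have key : ∀ m n, m ≤ n → ‖a n ξ - a m ξ‖ ^ 2 ≤
        2 * C * |(inner ℂ ξ ((a n) ξ)).re - (inner ℂ ξ ((a m) ξ)).re| := fun m n hmn => by
      have h0 : 0 ≤ a n - a m := sub_nonneg.2 (hmono hmn)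
      have h1 := norm_apply_sq_le_of_nonneg h0 ξ
      have h2 : 0 ≤ inner ℂ ξ ((a n - a m) ξ) :=
        ((ContinuousLinearMap.nonneg_iff_isPositive _).1 h0).inner_nonneg_right ξ
      have h3 : ‖inner ℂ ξ ((a n - a m) ξ)‖ = |(inner ℂ ξ ((a n - a m) ξ)).re| := by
        exact (Complex.abs_re_eq_norm.2 ((Complex.le_def.1 h2).2).symm).symm
      rw [h3, sub_apply, inner_sub_right, Complex.sub_re] at h1
      refine h1.trans ?_
      gcongr
      exact (norm_sub_le _ _).trans (by linarith [hC n, hC m])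
    rw [Metric.cauchySeq_iff']
    intro ε hε
    have hC0 : 0 ≤ C := (norm_nonneg _).trans (hC 0)
    -- The `+ 1` keeps the denominator positive when `C = 0`.
    obtain ⟨N, hN⟩ := Metric.cauchySeq_iff'.1 (hq ξ) (ε ^ 2 / (2 * C + 1)) (by positivity)
    refine ⟨N, fun n hn => ?_⟩
    have h1 := hN n hn
    rw [Real.dist_eq, lt_div_iff₀ (by positivity)] at h1
    rw [dist_eq_norm]
    refine lt_of_pow_lt_pow_left₀ 2 hε.le ((key N n hn).trans_lt ?_)
    nlinarith [abs_nonneg ((inner ℂ ξ ((a n) ξ)).re - (inner ℂ ξ ((a N) ξ)).re), sq_nonneg ε]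
  choose f hf using fun ξ => cauchySeq_tendsto_of_complete (hc ξ)
  exact ⟨continuousLinearMapOfTendsto a (tendsto_pi_nhds.2 hf), hf⟩

/-- A bounded sesquilinear form is given by an operator. -/
lemma exists_operator_of_sesquilinear [CompleteSpace H] (B : H → H → ℂ) {C : ℝ}
    (hal : ∀ ξ ξ' η, B (ξ + ξ') η = B ξ η + B ξ' η) (har : ∀ ξ η η', B ξ (η + η') = B ξ η + B ξ η')
    (hsl : ∀ (c : ℂ) ξ η, B (c • ξ) η = starRingEnd ℂ c * B ξ η)
    (hsr : ∀ (c : ℂ) ξ η, B ξ (c • η) = c * B ξ η)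
    (hC : ∀ ξ η, ‖B ξ η‖ ≤ C * ‖ξ‖ * ‖η‖) :
    ∃ T : H →L[ℂ] H, ∀ ξ η, inner ℂ ξ (T η) = B ξ η := by
  let B' : H →L⋆[ℂ] H →L[ℂ] ℂ := LinearMap.mkContinuous₂
    (LinearMap.mk₂'ₛₗ (starRingEnd ℂ) (RingHom.id ℂ) B hal hsl har hsr) C hC
  refine ⟨ContinuousLinearMap.adjoint (InnerProductSpace.continuousLinearMapOfBilin B'),
    fun ξ η => ?_⟩
  rw [ContinuousLinearMap.adjoint_inner_right, InnerProductSpace.continuousLinearMapOfBilin_apply]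
  rfl

/-- A bounded sequence of operators all of whose matrix coefficients converge converges weakly. -/
lemma exists_weak_limit [CompleteSpace H] {a : ℕ → H →L[ℂ] H} {C : ℝ} (hC : ∀ n, ‖a n‖ ≤ C)
    (h : ∀ ξ η, ∃ l, Tendsto (fun n => inner ℂ ξ (a n η)) atTop (𝓝 l)) :
    ∃ b, WeakTendsto a b := by
  choose B hB using h
  obtain ⟨T, hT⟩ := exists_operator_of_sesquilinear B (C := C)
    (fun ξ ξ' η => tendsto_nhds_unique (hB _ _)
      (by simpa [inner_add_left] using (hB ξ η).add (hB ξ' η)))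
    (fun ξ η η' => tendsto_nhds_unique (hB _ _)
      (by simpa [inner_add_right] using (hB ξ η).add (hB ξ η')))
    (fun c ξ η => tendsto_nhds_unique (hB _ _)
      (by simpa [inner_smul_left, mul_comm] using (hB ξ η).const_mul (starRingEnd ℂ c)))
    (fun c ξ η => tendsto_nhds_unique (hB _ _)
      (by simpa [inner_smul_right] using (hB ξ η).const_mul c))
    (fun ξ η => by
      refine le_of_tendsto (hB ξ η).norm (Eventually.of_forall fun n => ?_)
      refine (norm_inner_le_norm _ _).trans ?_
      rw [mul_comm C, mul_assoc]
      gcongr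
      exact ((a n).le_opNorm η).trans (by gcongr; exact hC n))
  exact ⟨T, fun ξ η => by rw [hT]; exact hB ξ η⟩

end WeakConvergence

/-! ### Ultraweakly continuous functionals -/

section Ultraweak

variable {H : Type u} [NormedAddCommGroup H] [InnerProductSpace ℂ H]

omit [InnerProductSpace ℂ H] in
lemma summable_norm_mul_norm (ξ η : lp (fun _ : ℕ => H) 2) :
    Summable fun n => ‖(ξ : ℕ → H) n‖ * ‖(η : ℕ → H) n‖ := by
  have h : ∀ ζ : lp (fun _ : ℕ => H) 2, Summable fun n => ‖(ζ : ℕ → H) n‖ ^ 2 := fun ζ => by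
    simpa using (lp.memℓp ζ).summable (by norm_num)
  refine Summable.of_nonneg_of_le (fun n => by positivity) (fun n => ?_) ((h ξ).add (h η))
  nlinarith [sq_nonneg (‖(ξ : ℕ → H) n‖ - ‖(η : ℕ → H) n‖), sq_nonneg ‖(ξ : ℕ → H) n‖,
    sq_nonneg ‖(η : ℕ → H) n‖]

lemma norm_inner_apply_le (x : H →L[ℂ] H) (ξ η : H) : ‖inner ℂ ξ (x η)‖ ≤ ‖x‖ * (‖ξ‖ * ‖η‖) := by
  refine (norm_inner_le_norm _ _).trans ?_
  rw [mul_left_comm]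
  gcongr
  exact x.le_opNorm η

lemma summable_inner_apply (ξ η : lp (fun _ : ℕ => H) 2) (x : H →L[ℂ] H) :
    Summable fun n => inner ℂ ((ξ : ℕ → H) n) (x ((η : ℕ → H) n)) :=
  Summable.of_norm_bounded ((summable_norm_mul_norm ξ η).mul_left ‖x‖)
    fun _ => norm_inner_apply_le _ _ _

variable [CompleteSpace H] {A : VonNeumannAlgebra H}

/-- The functional `x ↦ ∑ₙ ⟪ξₙ, x ηₙ⟫`. -/
def ultraweakFunctional (A : VonNeumannAlgebra H) (ξ η : lp (fun _ : ℕ => H) 2) : A →ₗ[ℂ] ℂ where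
  toFun x := ∑' n, inner ℂ ((ξ : ℕ → H) n) ((x : H →L[ℂ] H) ((η : ℕ → H) n))
  map_add' x y := by
    rw [← (summable_inner_apply ξ η _).tsum_add (summable_inner_apply ξ η _)]
    simp
  map_smul' c x := by
    rw [RingHom.id_apply, smul_eq_mul, ← tsum_mul_left]
    simp

/-- Sequences supported at `0` give the vector functionals, so ultraweak convergence yields weak
convergence. -/
lemma ultraweakFunctional_single (ξ η : H) (x : A) :
    ultraweakFunctional A (lp.single 2 0 ξ) (lp.single 2 0 η) x
      = inner ℂ ξ ((x : H →L[ℂ] H) η) := by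
  change (∑' n, _) = _
  rw [tsum_eq_single 0]
  · simp
  · intro n hn
    simp [Pi.single_eq_of_ne hn]

lemma tendsto_ultraweak_iff {a : ℕ → A} {b : A} :
    Tendsto a atTop (@nhds A (ultraweakTopology A) b) ↔
      ∀ ξ η, Tendsto (fun n => ultraweakFunctional A ξ η (a n)) atTop
        (𝓝 (ultraweakFunctional A ξ η b)) := by
  rw [nhds_iInf, tendsto_iInf]
  refine forall_congr' fun ξ => ?_
  rw [nhds_iInf, tendsto_iInf]
  refine forall_congr' fun η => ?_
  rw [nhds_induced, tendsto_comap_iff]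
  rfl

/-- On bounded sequences, weak convergence implies ultraweak convergence. -/
lemma WeakTendsto.ultraweak {a : ℕ → A} {b : A}
    (h : WeakTendsto (fun n => (a n : H →L[ℂ] H)) (b : H →L[ℂ] H)) {C : ℝ} (hC : ∀ n, ‖a n‖ ≤ C) :
    Tendsto a atTop (@nhds A (ultraweakTopology A) b) := by
  rw [tendsto_ultraweak_iff]
  intro ξ η
  refine tendsto_tsum_of_dominated_convergence ((summable_norm_mul_norm ξ η).mul_left C)
    (fun k => h _ _) (Eventually.of_forall fun n k => ?_)
  refine (norm_inner_apply_le _ _ _).trans ?_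
  gcongr
  exact hC n

/-- Normal maps preserve weak convergence of bounded sequences. -/
lemma IsNormalMap.weakTendsto {f : A → A} (hf : IsNormalMap f) {a : ℕ → A} {b : A}
    (h : WeakTendsto (fun n => (a n : H →L[ℂ] H)) (b : H →L[ℂ] H)) {C : ℝ} (hC : ∀ n, ‖a n‖ ≤ C) :
    WeakTendsto (fun n => (f (a n) : H →L[ℂ] H)) (f b : H →L[ℂ] H) := by
  have h1 : Tendsto (fun n => f (a n)) atTop (@nhds A (ultraweakTopology A) (f b)) :=
    (@Continuous.tendsto A A (ultraweakTopology A) (ultraweakTopology A) f hf b).comp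
      (h.ultraweak hC)
  intro ξ η
  simpa only [ultraweakFunctional_single] using
    tendsto_ultraweak_iff.1 h1 (lp.single 2 0 ξ) (lp.single 2 0 η)

/-- A linear functional continuous for the topology induced by a family of functionals is a finite
combination of them. Normality thus makes `σ` act on ultraweak functionals. -/
lemma IsNormalMap.mem_span_ultraweakFunctional {σ : Module.End ℂ A} (hσ : IsNormalMap σ)
    (ξ η : H) :
    ultraweakFunctional A (lp.single 2 0 ξ) (lp.single 2 0 η) ∘ₗ σ ∈
      Submodule.span ℂ (Set.range fun p : lp (fun _ : ℕ => H) 2 × lp (fun _ : ℕ => H) 2 =>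
        ultraweakFunctional A p.1 p.2) := by
  rw [LinearMap.mem_span_iff_continuous, iInf_prod]
  refine @Continuous.comp A A ℂ (ultraweakTopology A) (ultraweakTopology A) inferInstance
    (⇑σ) (ultraweakFunctional A (lp.single 2 0 ξ) (lp.single 2 0 η)) ?_ hσ
  exact continuous_iff_le_induced.2 (iInf₂_le (f := fun ξ η =>
    TopologicalSpace.induced (ultraweakFunctional A ξ η) inferInstance)
    (lp.single 2 0 ξ) (lp.single 2 0 η))

end Ultraweak

/-! ### Markov maps -/

section Markov

variable {H : Type u} [NormedAddCommGroup H] [InnerProductSpace ℂ H] [CompleteSpace H]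
  {A : VonNeumannAlgebra H}

/-- A normal unital Schwarz map of a von Neumann algebra into itself. -/
class IsMarkovMap (σ : Module.End ℂ A) : Prop where
  map_one : σ 1 = 1
  schwarz : ∀ x : A, star (σ x) * σ x ≤ σ (star x * x)
  normal : IsNormalMap σ

namespace IsMarkovMap

lemma map_nonneg (σ : Module.End ℂ A) [IsMarkovMap σ] {x : A} (hx : 0 ≤ x) : 0 ≤ σ x := by
  obtain ⟨s, rfl⟩ := CStarAlgebra.nonneg_iff_eq_star_mul_self.1 hx
  exact (star_mul_self_nonneg _).trans (schwarz s)

lemma map_le_map (σ : Module.End ℂ A) [IsMarkovMap σ] {x y : A} (h : x ≤ y) : σ x ≤ σ y := by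
  have := map_nonneg σ (sub_nonneg.2 h)
  rwa [map_sub, sub_nonneg] at this

lemma map_star (σ : Module.End ℂ A) [IsMarkovMap σ] (x : A) : σ (star x) = star (σ x) :=
  StarHomClass.map_star (PositiveLinearMap.mk₀ σ fun _ h => map_nonneg σ h) x

/-- By Schwarz and unitality, `σ(x)⋆ σ(x) ≤ σ(x⋆ x) ≤ ‖x‖² 1`. -/
lemma norm_map_le (σ : Module.End ℂ A) [IsMarkovMap σ] (x : A) : ‖σ x‖ ≤ ‖x‖ := by
  rcases subsingleton_or_nontrivial A with h | h
  · rw [Subsingleton.elim (σ x) x]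
  have h1 : star x * x ≤ (‖x‖ ^ 2 : ℝ) • (1 : A) := by
    have := (IsSelfAdjoint.star_mul_self x).le_algebraMap_norm_self
    rwa [CStarRing.norm_star_mul_self, ← sq, Algebra.algebraMap_eq_smul_one] at this
  have h2 : σ ((‖x‖ ^ 2 : ℝ) • (1 : A)) = (‖x‖ ^ 2 : ℝ) • (1 : A) := by
    rw [← Complex.coe_smul, map_smul, map_one]
  have h3 : star (σ x) * σ x ≤ (‖x‖ ^ 2 : ℝ) • (1 : A) :=
    (schwarz x).trans ((map_le_map σ h1).trans h2.le)
  have h4 := CStarAlgebra.norm_le_norm_of_nonneg_of_le (star_mul_self_nonneg _) h3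
  rw [CStarRing.norm_star_mul_self, norm_smul, norm_one, mul_one, ← sq] at h4
  exact le_of_pow_le_pow_left₀ two_ne_zero (norm_nonneg _) (h4.trans (by simp))

instance pow (σ : Module.End ℂ A) [h : IsMarkovMap σ] (n : ℕ) : IsMarkovMap (σ ^ n) := by
  induction n with
  | zero =>
    refine ⟨rfl, fun x => le_rfl, ?_⟩
    exact @continuous_id A (ultraweakTopology A)
  | succ n ih =>
    rw [pow_succ']
    refine ⟨?_, fun x => ?_, ?_⟩
    · rw [Module.End.mul_apply, ih.map_one, h.map_one]
    · rw [Module.End.mul_apply, Module.End.mul_apply]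
      exact (schwarz _).trans (map_le_map σ (ih.schwarz x))
    · exact @Continuous.comp A A A (ultraweakTopology A) (ultraweakTopology A)
        (ultraweakTopology A) (⇑(σ ^ n)) (⇑σ) h.normal ih.normal

lemma norm_pow_apply_le (σ : Module.End ℂ A) [IsMarkovMap σ] (n : ℕ) (x : A) :
    ‖(σ ^ n) x‖ ≤ ‖x‖ := norm_map_le (σ ^ n) x

lemma continuous (σ : Module.End ℂ A) [IsMarkovMap σ] : Continuous σ :=
  AddMonoidHomClass.continuous_of_bound σ 1 fun x => by simpa using norm_map_le σ x

end IsMarkovMap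

end Markov

/-! ### The Choi-Effros product on the fixed points of a Markov map -/

section Polarization

variable {E F : Type*} [AddCommGroup E] [Module ℂ E] [AddCommGroup F] [Module ℂ F]

/-- A submodule that contains the values of a sesquilinear map on the diagonal contains all of its
values. -/
lemma sesquilinear_mem_of_diagonal (B : E →ₗ⋆[ℂ] E →ₗ[ℂ] F) (S : Submodule ℂ F)
    (h : ∀ w, B w w ∈ S) (x y : E) : B x y ∈ S := by
  -- Polarization for a form that is conjugate-linear in the first variable.
  have key : (4 : ℂ) • B x y = B (x + y) (x + y) - B (x - y) (x - y)
      - Complex.I • B (x + Complex.I • y) (x + Complex.I • y)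
      + Complex.I • B (x - Complex.I • y) (x - Complex.I • y) := by
    simp only [map_add, map_sub, LinearMap.add_apply, LinearMap.sub_apply, map_smulₛₗ,
      LinearMap.smul_apply, smul_add, smul_sub, smul_smul, Complex.conj_I, RingHom.id_apply,
      mul_neg, Complex.I_mul_I]
    module
  rw [← inv_smul_smul₀ (show (4 : ℂ) ≠ 0 by norm_num) (B x y), key]
  exact S.smul_mem _ (S.add_mem (S.sub_mem (S.sub_mem (h _) (h _)) (S.smul_mem _ (h _)))
    (S.smul_mem _ (h _)))

end Polarization

/-! ### Fixed points, null elements and the limit product. -/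

section Harmonic

variable {H : Type u} [NormedAddCommGroup H] [InnerProductSpace ℂ H] [CompleteSpace H]
  {A : VonNeumannAlgebra H}

/-- The fixed points of `σ`. -/
def harmonicSubmodule (σ : Module.End ℂ A) : Submodule ℂ A where
  carrier := {x | σ x = x}
  add_mem' {x y} hx hy := by simp_all
  zero_mem' := by simp
  smul_mem' c x hx := by simp_all

lemma mem_harmonicSubmodule {σ : Module.End ℂ A} {x : A} :
    x ∈ harmonicSubmodule σ ↔ σ x = x := Iff.rfl

lemma pow_apply_of_mem_harmonic {σ : Module.End ℂ A} {x : A} (hx : x ∈ harmonicSubmodule σ)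
    (n : ℕ) : (σ ^ n) x = x := by
  induction n with
  | zero => rfl
  | succ n ih => rw [pow_succ', Module.End.mul_apply, ih, hx]

/-- The vectors `a` for which `σⁿ(a)` converges strongly. -/
def strongLimitSubmodule (σ : Module.End ℂ A) : Submodule ℂ A where
  carrier := {a | ∃ b : A, ∀ ξ : H,
    Tendsto (fun n => (((σ ^ n) a : A) : H →L[ℂ] H) ξ) atTop (𝓝 ((b : H →L[ℂ] H) ξ))}
  add_mem' := by
    rintro a a' ⟨b, hb⟩ ⟨b', hb'⟩
    exact ⟨b + b', fun ξ => by simpa using (hb ξ).add (hb' ξ)⟩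
  zero_mem' := ⟨0, fun ξ => by simp⟩
  smul_mem' := by
    rintro c a ⟨b, hb⟩
    exact ⟨c • b, fun ξ => by simpa using (hb ξ).const_smul c⟩

/-- The elements `a` for which `σⁿ(a a⋆)` tends to zero weakly. -/
def weakNullSubmodule (σ : Module.End ℂ A) [IsMarkovMap σ] : Submodule ℂ A where
  carrier := {a | WeakTendsto (fun n => (((σ ^ n) (a * star a) : A) : H →L[ℂ] H)) 0}
  add_mem' := by
    intro a b ha hb
    have h1 : ∀ n, (((σ ^ n) ((a + b) * star (a + b)) : A) : H →L[ℂ] H) ≤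
        (((σ ^ n) ((2 : ℂ) • (a * star a) + (2 : ℂ) • (b * star b)) : A) : H →L[ℂ] H) := fun n => by
      refine IsMarkovMap.map_le_map (σ ^ n) ?_
      rw [← sub_nonneg]
      -- The parallelogram identity bounds `(a + b)(a + b)⋆` by `2 a a⋆ + 2 b b⋆`.
      have : (2 : ℂ) • (a * star a) + (2 : ℂ) • (b * star b) - (a + b) * star (a + b)
          = (a - b) * star (a - b) := by
        simp only [star_add, star_sub, two_smul]
        noncomm_ring
      rw [this]
      exact mul_star_self_nonneg _
    refine WeakTendsto.zero_of_le
      (fun n => IsMarkovMap.map_nonneg (σ ^ n) (mul_star_self_nonneg _)) h1 ?_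
    have := (WeakTendsto.smul 2 ha).add (WeakTendsto.smul 2 hb)
    simpa using this
  zero_mem' := by
    simpa using WeakTendsto.const 0
  smul_mem' := by
    intro c a ha
    have := WeakTendsto.smul (starRingEnd ℂ c * c) ha
    simpa [smul_smul] using this

/-- With `a = s⋆ s`, conjugate `s s⋆ ≤ ‖s s⋆‖ 1` by `s`. -/
lemma mul_self_le_norm_smul_of_nonneg {a : A} (ha : 0 ≤ a) : a * a ≤ (‖a‖ : ℂ) • a := by
  obtain ⟨s, rfl⟩ := CStarAlgebra.nonneg_iff_eq_star_mul_self.1 ha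
  have := CStarAlgebra.star_left_conjugate_le_norm_smul (a := s) (b := s * star s)
    (IsSelfAdjoint.mul_star_self s)
  rw [CStarRing.norm_self_mul_star, ← CStarRing.norm_star_mul_self, ← Complex.coe_smul] at this
  simpa only [mul_assoc] using this

variable (σ : Module.End ℂ A) [IsMarkovMap σ]

lemma star_mem_harmonicSubmodule {x : A} (hx : x ∈ harmonicSubmodule σ) :
    star x ∈ harmonicSubmodule σ := by
  rw [mem_harmonicSubmodule] at hx ⊢
  rw [IsMarkovMap.map_star, hx]

lemma one_mem_harmonicSubmodule : (1 : A) ∈ harmonicSubmodule σ := IsMarkovMap.map_one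

lemma star_mul_self_le_pow {x : A} (hx : x ∈ harmonicSubmodule σ) (n : ℕ) :
    star x * x ≤ (σ ^ n) (star x * x) := by
  have := IsMarkovMap.schwarz (σ := σ ^ n) x
  rwa [pow_apply_of_mem_harmonic hx] at this

/-- Schwarz gives `x⋆ x ≤ σ(x⋆ x)`; applying `σⁿ` makes the sequence increasing, and it is bounded
because `σ` is contractive. -/
lemma star_mul_self_mem_strongLimitSubmodule {x : A} (hx : x ∈ harmonicSubmodule σ) :
    star x * x ∈ strongLimitSubmodule σ := by
  have hm : Monotone fun n => (((σ ^ n) (star x * x) : A) : H →L[ℂ] H) :=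
    monotone_nat_of_le_succ fun n => by
      rw [pow_succ, Module.End.mul_apply]
      refine IsMarkovMap.map_le_map (σ ^ n) ?_
      simpa using star_mul_self_le_pow σ hx 1
  obtain ⟨b, hb⟩ := exists_strong_limit_of_monotone hm (C := ‖star x * x‖)
    fun n => IsMarkovMap.norm_pow_apply_le σ n _
  exact ⟨⟨b, (WeakTendsto.of_strong hb).mem A fun n => Subtype.property _⟩, hb⟩

/-- The sesquilinear map `(x, y) ↦ x⋆ y` on the fixed points. -/
def harmonicForm : harmonicSubmodule σ →ₗ⋆[ℂ] harmonicSubmodule σ →ₗ[ℂ] A :=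
  LinearMap.mk₂'ₛₗ (starRingEnd ℂ) (RingHom.id ℂ) (fun x y => star (x : A) * (y : A))
    (by simp [add_mul]) (by simp) (by simp [mul_add]) (by simp)

lemma mul_mem_strongLimitSubmodule {x y : A} (hx : x ∈ harmonicSubmodule σ)
    (hy : y ∈ harmonicSubmodule σ) : x * y ∈ strongLimitSubmodule σ := by
  simpa [harmonicForm] using sesquilinear_mem_of_diagonal (harmonicForm σ) (strongLimitSubmodule σ)
    (fun w => star_mul_self_mem_strongLimitSubmodule σ w.2)
    ⟨_, star_mem_harmonicSubmodule σ hx⟩ ⟨y, hy⟩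

/-- Normality moves `σ` inside the limit, where it only shifts the sequence. -/
lemma weak_limit_mem_harmonicSubmodule {a b : A}
    (h : WeakTendsto (fun n => (((σ ^ n) a : A) : H →L[ℂ] H)) (b : H →L[ℂ] H)) :
    b ∈ harmonicSubmodule σ := by
  have h1 := IsNormalMap.weakTendsto (IsMarkovMap.normal (σ := σ)) h
    (fun n => IsMarkovMap.norm_pow_apply_le σ n a)
  have h2 := h.comp_tendsto (tendsto_add_atTop_nat 1)
  simp only [pow_succ', Module.End.mul_apply] at h2
  exact Subtype.ext (h1.unique h2)

lemma exists_harmonic_limit (x y : harmonicSubmodule σ) : ∃ b : harmonicSubmodule σ, ∀ ξ : H,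
    Tendsto (fun n => (((σ ^ n) (x * y : A) : A) : H →L[ℂ] H) ξ) atTop
      (𝓝 (((b : A) : H →L[ℂ] H) ξ)) := by
  obtain ⟨b, hb⟩ := mul_mem_strongLimitSubmodule σ x.2 y.2
  exact ⟨⟨b, weak_limit_mem_harmonicSubmodule σ (WeakTendsto.of_strong hb)⟩, hb⟩

/-- The Choi-Effros product of two fixed points. -/
def harmonicMul (x y : harmonicSubmodule σ) : harmonicSubmodule σ :=
  (exists_harmonic_limit σ x y).choose

lemma tendsto_harmonicMul (x y : harmonicSubmodule σ) (ξ : H) :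
    Tendsto (fun n => (((σ ^ n) (x * y : A) : A) : H →L[ℂ] H) ξ) atTop
      (𝓝 (((harmonicMul σ x y : A) : H →L[ℂ] H) ξ)) :=
  (exists_harmonic_limit σ x y).choose_spec ξ

lemma weakTendsto_harmonicMul (x y : harmonicSubmodule σ) :
    WeakTendsto (fun n => (((σ ^ n) (x * y : A) : A) : H →L[ℂ] H))
      ((harmonicMul σ x y : A) : H →L[ℂ] H) :=
  WeakTendsto.of_strong (tendsto_harmonicMul σ x y)

variable {σ} in
-- Strong convergence is needed only for existence; algebraic identities follow from uniqueness of
-- weak limits.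
lemma harmonicMul_eq {x y z : harmonicSubmodule σ}
    (h : WeakTendsto (fun n => (((σ ^ n) (x * y : A) : A) : H →L[ℂ] H))
      ((z : A) : H →L[ℂ] H)) : harmonicMul σ x y = z :=
  Subtype.ext (Subtype.ext ((weakTendsto_harmonicMul σ x y).unique h))

/-- The involution on the fixed points. -/
def harmonicStar (x : harmonicSubmodule σ) : harmonicSubmodule σ :=
  ⟨star (x : A), star_mem_harmonicSubmodule σ x.2⟩

/-- The bilinear map `harmonicMul`. -/
def harmonicMulBilin : harmonicSubmodule σ →ₗ[ℂ] harmonicSubmodule σ →ₗ[ℂ] harmonicSubmodule σ :=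
  LinearMap.mk₂ ℂ (harmonicMul σ)
    (fun x x' y => harmonicMul_eq (by
      simpa [add_mul] using (weakTendsto_harmonicMul σ x y).add (weakTendsto_harmonicMul σ x' y)))
    (fun c x y => harmonicMul_eq (by simpa using (weakTendsto_harmonicMul σ x y).smul c))
    (fun x y y' => harmonicMul_eq (by
      simpa [mul_add] using (weakTendsto_harmonicMul σ x y).add (weakTendsto_harmonicMul σ x y')))
    (fun c x y => harmonicMul_eq (by simpa using (weakTendsto_harmonicMul σ x y).smul c))

/-- The sesquilinear map `(x, y) ↦ x⋆ ∘ y - x⋆ y`. -/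
def harmonicDefect : harmonicSubmodule σ →ₗ⋆[ℂ] harmonicSubmodule σ →ₗ[ℂ] A :=
  LinearMap.mk₂'ₛₗ (starRingEnd ℂ) (RingHom.id ℂ)
    (fun x y => (harmonicMulBilin σ (harmonicStar σ x) y : A) - star (x : A) * (y : A))
    (fun x x' y => by
      have : harmonicStar σ (x + x') = harmonicStar σ x + harmonicStar σ x' :=
        Subtype.ext (star_add _ _)
      simp only [this, map_add, LinearMap.add_apply, Submodule.coe_add, star_add, add_mul]
      abel)
    (fun c x y => by
      have : harmonicStar σ (c • x) = starRingEnd ℂ c • harmonicStar σ x :=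
        Subtype.ext (star_smul _ _)
      simp [this, smul_sub])
    (fun x y y' => by
      simp only [map_add, Submodule.coe_add, mul_add]
      abel)
    (fun c x y => by simp [smul_sub])

lemma star_mul_self_le_harmonicMul (x : harmonicSubmodule σ) :
    star (x : A) * (x : A) ≤ harmonicMul σ (harmonicStar σ x) x :=
  WeakTendsto.le_of_le (WeakTendsto.const ((star (x : A) * (x : A) : A) : H →L[ℂ] H))
    (weakTendsto_harmonicMul σ (harmonicStar σ x) x) fun n => star_mul_self_le_pow σ x.2 n

/-- On the diagonal the defect `d` is positive and `σⁿ(d) = w⋆ ∘ w - σⁿ(w⋆ w)` tends to zero, while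
`d d⋆ = d² ≤ ‖d‖ d`. Null elements form a subspace, so polarization gives the rest. -/
lemma harmonicMul_sub_mul_mem_weakNullSubmodule (x y : harmonicSubmodule σ) :
    (harmonicMul σ x y : A) - (x : A) * (y : A) ∈ weakNullSubmodule σ := by
  have key : ∀ w : harmonicSubmodule σ, harmonicDefect σ w w ∈ weakNullSubmodule σ := fun w => by
    set d := harmonicDefect σ w w with hd
    have hd0 : 0 ≤ d := sub_nonneg.2 (star_mul_self_le_harmonicMul σ w)
    have h1 : WeakTendsto (fun n => (((σ ^ n) d : A) : H →L[ℂ] H)) 0 := by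
      have h2 := (WeakTendsto.const
        (((harmonicMul σ (harmonicStar σ w) w : A)) : H →L[ℂ] H)).sub
        (weakTendsto_harmonicMul σ (harmonicStar σ w) w)
      rw [sub_self] at h2
      refine (congrArg (WeakTendsto · 0) (funext fun n => ?_)).mp h2
      have : d = (harmonicMul σ (harmonicStar σ w) w : A)
        - (harmonicStar σ w : A) * (w : A) := rfl
      rw [this, map_sub, pow_apply_of_mem_harmonic (Subtype.property _)]
      rfl
    refine WeakTendsto.zero_of_le
      (fun n => IsMarkovMap.map_nonneg (σ ^ n) (mul_star_self_nonneg d))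
      (b := fun n => (((σ ^ n) ((‖d‖ : ℂ) • d) : A) : H →L[ℂ] H)) (fun n => ?_)
      (by simpa using h1.smul (‖d‖ : ℂ))
    refine IsMarkovMap.map_le_map (σ ^ n) ?_
    rw [(IsSelfAdjoint.of_nonneg hd0).star_eq]
    exact mul_self_le_norm_smul_of_nonneg hd0
  have := sesquilinear_mem_of_diagonal (harmonicDefect σ) (weakNullSubmodule σ) key (harmonicStar σ x) y
  have e : harmonicStar σ (harmonicStar σ x) = x := Subtype.ext (star_star _)
  simpa [harmonicDefect, e, harmonicMulBilin, harmonicStar] using this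

/-- `σⁿ(a b)` tends to zero weakly if `a` is in the null space. -/
lemma weakTendsto_mul_of_mem_weakNullSubmodule {a : A} (ha : a ∈ weakNullSubmodule σ) (b : A) :
    WeakTendsto (fun n => (((σ ^ n) (a * b) : A) : H →L[ℂ] H)) 0 := by
  -- Schwarz for the adjoint: `σⁿ(a b) σⁿ(a b)⋆ ≤ σⁿ(a b b⋆ a⋆) ≤ ‖b b⋆‖ σⁿ(a a⋆)`.
  have h1 : WeakTendsto (fun n => star (((σ ^ n) (star (a * b)) : A) : H →L[ℂ] H)
      * (((σ ^ n) (star (a * b)) : A) : H →L[ℂ] H)) 0 := by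
    refine WeakTendsto.zero_of_le (fun n => star_mul_self_nonneg _)
      (b := fun n => (((σ ^ n) (((‖b * star b‖ : ℝ) : ℂ) • (a * star a)) : A) : H →L[ℂ] H))
      (fun n => ?_) ?_
    · refine (IsMarkovMap.schwarz (σ := σ ^ n) (star (a * b))).trans ?_
      refine IsMarkovMap.map_le_map (σ ^ n) ?_
      have := CStarAlgebra.star_left_conjugate_le_norm_smul (a := star a) (b := b * star b)
        (IsSelfAdjoint.mul_star_self b)
      rw [← Complex.coe_smul] at this
      simpa only [star_star, star_mul, mul_assoc] using this
    · have : WeakTendsto (fun n => (((σ ^ n) (a * star a) : A) : H →L[ℂ] H)) 0 := ha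
      simpa using this.smul ((‖b * star b‖ : ℝ) : ℂ)
  -- The adjoints tend to zero strongly; taking adjoints again preserves only weak convergence.
  have h2 := (WeakTendsto.of_strong (b := 0)
    (tendsto_zero_of_weakTendsto_star_mul h1)).star
  simpa only [IsMarkovMap.map_star, StarMemClass.coe_star, star_star, star_zero] using h2

lemma harmonicStar_harmonicMul (x y : harmonicSubmodule σ) :
    harmonicStar σ (harmonicMul σ x y) = harmonicMul σ (harmonicStar σ y) (harmonicStar σ x) := by
  refine (harmonicMul_eq ?_).symm
  have := (weakTendsto_harmonicMul σ x y).star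
  simpa [harmonicStar, ← IsMarkovMap.map_star, ← StarMemClass.coe_star] using this

/-- Replacing `x y` by `x ∘ y` changes the triple product by a null element times `z`, which
disappears in the limit. -/
lemma weakTendsto_triple (x y z : harmonicSubmodule σ) :
    WeakTendsto (fun n => (((σ ^ n) ((x : A) * (y : A) * (z : A)) : A) : H →L[ℂ] H))
      ((harmonicMul σ (harmonicMul σ x y) z : A) : H →L[ℂ] H) := by
  have h1 := weakTendsto_mul_of_mem_weakNullSubmodule σ
    (harmonicMul_sub_mul_mem_weakNullSubmodule σ x y) (z : A)
  have h2 := (weakTendsto_harmonicMul σ (harmonicMul σ x y) z).sub h1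
  rw [sub_zero] at h2
  simpa [sub_mul] using h2

/-- Both bracketings are the weak limit of `σⁿ(x y z)`; the right-hand one is reduced to
`weakTendsto_triple` by the involution. -/
lemma harmonicMul_assoc (x y z : harmonicSubmodule σ) :
    harmonicMul σ (harmonicMul σ x y) z = harmonicMul σ x (harmonicMul σ y z) := by
  have h1 := (weakTendsto_triple σ (harmonicStar σ z) (harmonicStar σ y) (harmonicStar σ x)).star
  have h2 := weakTendsto_triple σ x y z
  have h3 : harmonicMul σ x (harmonicMul σ y z) = harmonicStar σ (harmonicMul σ
      (harmonicMul σ (harmonicStar σ z) (harmonicStar σ y)) (harmonicStar σ x)) := by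
    rw [← harmonicStar_harmonicMul, ← harmonicStar_harmonicMul]
    exact Subtype.ext (star_star _).symm
  rw [h3]
  refine Subtype.ext (Subtype.ext (h2.unique ?_))
  simpa [harmonicStar, ← IsMarkovMap.map_star, ← StarMemClass.coe_star, mul_assoc] using h1

/-- The C⋆-algebra of fixed points of a Markov map with the Choi-Effros product. -/
def HarmonicAlgebra (σ : Module.End ℂ A) : Type u := harmonicSubmodule σ

namespace HarmonicAlgebra

instance : NormedAddCommGroup (HarmonicAlgebra σ) :=
  inferInstanceAs (NormedAddCommGroup (harmonicSubmodule σ))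

instance : NormedSpace ℂ (HarmonicAlgebra σ) :=
  inferInstanceAs (NormedSpace ℂ (harmonicSubmodule σ))

instance : CompleteSpace (HarmonicAlgebra σ) := by
  have : IsClosed (harmonicSubmodule σ : Set A) :=
    isClosed_eq (IsMarkovMap.continuous σ) continuous_id
  exact this.completeSpace_coe

instance : Ring (HarmonicAlgebra σ) where
  __ := (inferInstance : AddCommGroup (HarmonicAlgebra σ))
  mul := harmonicMul σ
  one := (⟨1, one_mem_harmonicSubmodule σ⟩ : harmonicSubmodule σ)
  left_distrib x y z := (harmonicMulBilin σ x).map_add y z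
  right_distrib x y z := (harmonicMulBilin σ).map_add₂ x y z
  zero_mul x := (harmonicMulBilin σ).map_zero₂ x
  mul_zero x := (harmonicMulBilin σ x).map_zero
  mul_assoc := harmonicMul_assoc σ
  one_mul x := harmonicMul_eq (σ := σ) (x := ⟨1, one_mem_harmonicSubmodule σ⟩) (by
    simpa [pow_apply_of_mem_harmonic (Subtype.property (p := (· ∈ harmonicSubmodule σ)) x)] using
      WeakTendsto.const _)
  mul_one x := harmonicMul_eq (σ := σ) (y := ⟨1, one_mem_harmonicSubmodule σ⟩) (by
    simpa [pow_apply_of_mem_harmonic (Subtype.property (p := (· ∈ harmonicSubmodule σ)) x)] using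
      WeakTendsto.const _)

instance : NormedRing (HarmonicAlgebra σ) where
  __ := (inferInstance : Ring (HarmonicAlgebra σ))
  __ := (inferInstance : NormedAddCommGroup (HarmonicAlgebra σ))
  norm_mul_le x y := (weakTendsto_harmonicMul σ x y).norm_le
    (mul_nonneg (norm_nonneg _) (norm_nonneg _))
    fun n => (IsMarkovMap.norm_pow_apply_le σ n _).trans (norm_mul_le _ _)

instance : NormedAlgebra ℂ (HarmonicAlgebra σ) where
  __ := (inferInstance : NormedSpace ℂ (HarmonicAlgebra σ))
  __ := Algebra.ofModule (R := ℂ) (A := HarmonicAlgebra σ)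
    (fun c x y => (harmonicMulBilin σ).map_smul₂ c x y)
    (fun c x y => (harmonicMulBilin σ x).map_smul c y)

instance : StarRing (HarmonicAlgebra σ) where
  star := harmonicStar σ
  star_involutive _ := Subtype.ext (star_star _)
  star_mul := harmonicStar_harmonicMul σ
  star_add _ _ := Subtype.ext (star_add _ _)

instance : CStarAlgebra (HarmonicAlgebra σ) where
  star_smul _ _ := Subtype.ext (star_smul _ _)
  norm_mul_self_le x := by
    -- The C⋆-inequality is inherited from `A` through `x⋆ x ≤ x⋆ ∘ x`.
    have h := CStarAlgebra.norm_le_norm_of_nonneg_of_le (star_mul_self_nonneg _)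
      (star_mul_self_le_harmonicMul σ x)
    rw [CStarRing.norm_star_mul_self] at h
    exact h

/-- The inclusion of the fixed points. -/
def incl : HarmonicAlgebra σ →ₗᵢ[ℂ] A := (harmonicSubmodule σ).subtypeₗᵢ

lemma incl_mem (x : HarmonicAlgebra σ) : incl σ x ∈ harmonicSubmodule σ := Subtype.property _

lemma range_incl : LinearMap.range (incl σ).toLinearMap = harmonicSubmodule σ :=
  Submodule.range_subtype _

lemma incl_one : incl σ 1 = 1 := rfl

lemma incl_star (x : HarmonicAlgebra σ) : incl σ (star x) = star (incl σ x) := rfl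

lemma weakTendsto_incl_mul (x y : HarmonicAlgebra σ) :
    WeakTendsto (fun n => (((σ ^ n) (incl σ x * incl σ y) : A) : H →L[ℂ] H))
      (incl σ (x * y) : H →L[ℂ] H) := weakTendsto_harmonicMul σ x y

end HarmonicAlgebra

end Harmonic

/-! ### The predual of the algebra of fixed points -/

namespace HarmonicAlgebra

variable {H : Type u} [NormedAddCommGroup H] [InnerProductSpace ℂ H] [CompleteSpace H]
  {A : VonNeumannAlgebra H} (σ : Module.End ℂ A) [IsMarkovMap σ]

/-- The functional `x ↦ ⟪ξ, x η⟫` on the fixed points. -/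
def vectorFunctional (ξ η : H) : StrongDual ℂ (HarmonicAlgebra σ) :=
  LinearMap.mkContinuous
    (ultraweakFunctional A (lp.single 2 0 ξ) (lp.single 2 0 η) ∘ₗ (incl σ).toLinearMap)
    (‖ξ‖ * ‖η‖) fun x => by
      rw [LinearMap.comp_apply, ultraweakFunctional_single, mul_comm]
      refine (norm_inner_apply_le _ _ _).trans ?_
      gcongr
      exact ((incl σ).norm_map x).le

lemma vectorFunctional_apply (ξ η : H) (x : HarmonicAlgebra σ) :
    vectorFunctional σ ξ η x = inner ℂ ξ ((incl σ x : H →L[ℂ] H) η) :=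
  ultraweakFunctional_single ξ η _

lemma norm_vectorFunctional_le (ξ η : H) : ‖vectorFunctional σ ξ η‖ ≤ ‖ξ‖ * ‖η‖ :=
  LinearMap.mkContinuous_norm_le _ (by positivity) _

/-- The closed span of the vector functionals. -/
def predualSubmodule : Submodule ℂ (StrongDual ℂ (HarmonicAlgebra σ)) :=
  (Submodule.span ℂ (Set.range fun p : H × H => vectorFunctional σ p.1 p.2)).topologicalClosure

/-- The predual of the algebra of fixed points. -/
def Predual : Type u := predualSubmodule σ

instance : NormedAddCommGroup (Predual σ) :=
  inferInstanceAs (NormedAddCommGroup (predualSubmodule σ))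

instance : NormedSpace ℂ (Predual σ) :=
  inferInstanceAs (NormedSpace ℂ (predualSubmodule σ))

instance : CompleteSpace (Predual σ) :=
  (Submodule.isClosed_topologicalClosure
    (Submodule.span ℂ (Set.range fun p : H × H => vectorFunctional σ p.1 p.2))).completeSpace_coe

/-- The inclusion of the predual in the dual. -/
def toDual : Predual σ →ₗᵢ[ℂ] StrongDual ℂ (HarmonicAlgebra σ) := (predualSubmodule σ).subtypeₗᵢ

/-- The vector functionals as elements of the predual. -/
def predualVector (ξ η : H) : Predual σ :=
  (⟨vectorFunctional σ ξ η,
    Submodule.le_topologicalClosure _ (Submodule.subset_span ⟨(ξ, η), rfl⟩)⟩ : predualSubmodule σ)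

lemma predualVector_apply (ξ η : H) (x : HarmonicAlgebra σ) :
    toDual σ (predualVector σ ξ η) x
      = inner ℂ ξ ((incl σ x : H →L[ℂ] H) η) := vectorFunctional_apply σ ξ η x

lemma norm_predualVector_le (ξ η : H) : ‖predualVector σ ξ η‖ ≤ ‖ξ‖ * ‖η‖ :=
  norm_vectorFunctional_le σ ξ η

variable {σ} in
lemma predual_ext {f g : Predual σ}
    (h : ∀ x, toDual σ f x
      = toDual σ g x) : f = g :=
  Subtype.ext (ContinuousLinearMap.ext h)

/-- The evaluation map into the dual of the predual. -/
def evaluation : HarmonicAlgebra σ →ₗᵢ[ℂ] StrongDual ℂ (Predual σ) where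
  toLinearMap := ((ContinuousLinearMap.flip (toDual σ).toContinuousLinearMap) :
    HarmonicAlgebra σ →ₗ[ℂ] StrongDual ℂ (Predual σ))
  norm_map' x := by
    refine le_antisymm ?_ ?_
    · refine ContinuousLinearMap.opNorm_le_bound _ (norm_nonneg _) fun f => ?_
      rw [mul_comm]
      exact (toDual σ f).le_opNorm x
    · set F : StrongDual ℂ (Predual σ) := ContinuousLinearMap.flip (toDual σ).toContinuousLinearMap x with hF
      change ‖x‖ ≤ ‖F‖
      rw [← (incl σ).norm_map x]
      refine ContinuousLinearMap.opNorm_le_bound (incl σ x : H →L[ℂ] H) (norm_nonneg _) fun η => ?_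
      -- Testing against `ξ = x η` yields `‖x η‖² ≤ ‖F‖ ‖x η‖ ‖η‖`.
      set ξ := (incl σ x : H →L[ℂ] H) η with hξ
      have h1 : ‖F (predualVector σ ξ η)‖ ≤ ‖F‖ * (‖ξ‖ * ‖η‖) :=
        (F.le_opNorm _).trans (by gcongr; exact norm_predualVector_le σ ξ η)
      have h2 : F (predualVector σ ξ η) = inner ℂ ξ ξ := predualVector_apply σ ξ η x
      rw [h2, inner_self_eq_norm_sq_to_K, norm_pow, RCLike.norm_ofReal, abs_norm, sq,
        mul_left_comm] at h1
      rcases (norm_nonneg ξ).eq_or_lt with h0 | h0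
      · rw [← h0]; positivity
      · exact le_of_mul_le_mul_left h1 h0

lemma evaluation_apply (x : HarmonicAlgebra σ) (f : Predual σ) :
    evaluation σ x f = toDual σ f x := rfl

lemma exists_operator_of_dual (F : StrongDual ℂ (Predual σ)) :
    ∃ T : H →L[ℂ] H, ∀ ξ η, inner ℂ ξ (T η) = F (predualVector σ ξ η) := by
  refine exists_operator_of_sesquilinear (fun ξ η => F (predualVector σ ξ η)) (C := ‖F‖)
    (fun ξ ξ' η => ?_) (fun ξ η η' => ?_) (fun c ξ η => ?_) (fun c ξ η => ?_) fun ξ η => ?_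
  · rw [← map_add]
    exact congrArg F (predual_ext fun x => by simp [predualVector_apply])
  · rw [← map_add]
    exact congrArg F (predual_ext fun x => by simp [predualVector_apply])
  · rw [← smul_eq_mul, ← map_smul]
    exact congrArg F (predual_ext fun x => by simp [predualVector_apply, mul_comm])
  · rw [← smul_eq_mul, ← map_smul]
    exact congrArg F (predual_ext fun x => by simp [predualVector_apply])
  · rw [mul_assoc]
    exact (F.le_opNorm _).trans (by gcongr; exact norm_predualVector_le σ ξ η)

variable {σ}

/-- Ultraweak functionals restrict to norm-convergent series in the predual, so `F` evaluates them
at `T` just as it does vector functionals. -/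
lemma hasSum_predualVector (F : StrongDual ℂ (Predual σ)) {T : H →L[ℂ] H}
    (hT : ∀ ξ η, inner ℂ ξ (T η) = F (predualVector σ ξ η)) (ξ η : lp (fun _ : ℕ => H) 2) :
    ∃ f : Predual σ, (∀ x, toDual σ f x
        = ultraweakFunctional A ξ η (incl σ x)) ∧
      F f = ∑' n, inner ℂ ((ξ : ℕ → H) n) (T ((η : ℕ → H) n)) := by
  have hs : Summable fun n => predualVector σ ((ξ : ℕ → H) n) ((η : ℕ → H) n) :=
    Summable.of_norm_bounded (summable_norm_mul_norm ξ η) fun n => norm_predualVector_le σ _ _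
  refine ⟨∑' n, predualVector σ ((ξ : ℕ → H) n) ((η : ℕ → H) n), fun x => ?_, ?_⟩
  · rw [← evaluation_apply, (evaluation σ x).map_tsum hs]
    exact tsum_congr fun n => predualVector_apply σ _ _ x
  · simp_rw [F.map_tsum hs, hT]

/-- For `g` in the commutant, `⟪g⋆ ξ, x η⟫` and `⟪ξ, x (g η)⟫` are the same functional of `x`, so
`F` cannot distinguish them. -/
lemma operator_mem (F : StrongDual ℂ (Predual σ)) {T : H →L[ℂ] H}
    (hT : ∀ ξ η, inner ℂ ξ (T η) = F (predualVector σ ξ η)) : T ∈ A := by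
  rw [← A.commutant_commutant, VonNeumannAlgebra.mem_commutant_iff]
  intro g hg
  have hg' := VonNeumannAlgebra.mem_commutant_iff.1 hg
  ext η
  refine ext_inner_left ℂ fun ξ => ?_
  rw [mul_apply_eq_comp, mul_apply_eq_comp,
    ← ContinuousLinearMap.adjoint_inner_left, hT, hT]
  refine congrArg F (predual_ext fun x => ?_)
  have h := congrArg (fun S : H →L[ℂ] H => inner ℂ ξ (S η)) (hg' (incl σ x) (Subtype.property _))
  simpa [predualVector_apply, ContinuousLinearMap.adjoint_inner_left] using h.symm

/-- A vector functional composed with `σ` is ultraweakly continuous and agrees with the original on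
fixed points. They are therefore one element of the predual, and its value under `F` is both matrix
coefficients, of `σ T` and of `T`. -/
lemma operator_harmonic (F : StrongDual ℂ (Predual σ)) {T : A}
    (hT : ∀ ξ η, inner ℂ ξ ((T : H →L[ℂ] H) η) = F (predualVector σ ξ η)) : σ T = T := by
  have key : ∀ φ ∈ Submodule.span ℂ
      (Set.range fun p : lp (fun _ : ℕ => H) 2 × lp (fun _ : ℕ => H) 2 =>
        ultraweakFunctional A p.1 p.2), ∃ f : Predual σ,
        (∀ x, toDual σ f x = φ (incl σ x)) ∧ F f = φ T := by
    intro φ hφ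
    induction hφ using Submodule.span_induction with
    | mem φ h =>
      obtain ⟨p, rfl⟩ := h
      exact hasSum_predualVector F hT p.1 p.2
    | zero => exact ⟨0, fun x => rfl, map_zero F⟩
    | add φ ψ _ _ h h' =>
      obtain ⟨f, hf, hf'⟩ := h
      obtain ⟨g, hg, hg'⟩ := h'
      exact ⟨f + g, fun x => by simp [hf, hg], by simp [hf', hg']⟩
    | smul c φ _ h =>
      obtain ⟨f, hf, hf'⟩ := h
      exact ⟨c • f, fun x => by simp [hf], by simp [hf']⟩
  refine Subtype.ext (ContinuousLinearMap.ext fun η => ext_inner_left ℂ fun ξ => ?_)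
  obtain ⟨f, hf, hf'⟩ := key _ (IsMarkovMap.normal (σ := σ)
    |>.mem_span_ultraweakFunctional ξ η)
  rw [LinearMap.comp_apply, ultraweakFunctional_single] at hf'
  rw [← hf', hT]
  refine congrArg F (predual_ext fun x => ?_)
  rw [hf, LinearMap.comp_apply, ultraweakFunctional_single, predualVector_apply,
    mem_harmonicSubmodule.1 (incl_mem σ x)]

variable (σ)

lemma evaluation_surjective : Function.Surjective (evaluation σ) := by
  intro F
  obtain ⟨T, hT⟩ := exists_operator_of_dual σ F
  let T' : A := ⟨T, operator_mem F hT⟩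
  let x : HarmonicAlgebra σ := (⟨T', operator_harmonic F hT⟩ : harmonicSubmodule σ)
  have hx : ∀ f : Predual σ, evaluation σ x f = F f := by
    have hvec : ∀ ξ η, evaluation σ x (predualVector σ ξ η) = F (predualVector σ ξ η) :=
      fun ξ η => (predualVector_apply σ ξ η x).trans (hT ξ η)
    have hspan : ∀ f ∈ Submodule.span ℂ (Set.range fun p : H × H => vectorFunctional σ p.1 p.2),
        ∃ g : Predual σ, toDual σ g = f ∧ evaluation σ x g = F g := by
      intro f hf
      induction hf using Submodule.span_induction with
      | mem f h => obtain ⟨p, rfl⟩ := h; exact ⟨predualVector σ p.1 p.2, rfl, hvec p.1 p.2⟩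
      | zero => exact ⟨0, map_zero _, by simp⟩
      | add f g _ _ h h' =>
        obtain ⟨f', rfl, hf⟩ := h
        obtain ⟨g', rfl, hg⟩ := h'
        exact ⟨f' + g', map_add _ _ _, by rw [map_add, map_add, hf, hg]⟩
      | smul c f _ h =>
        obtain ⟨f', rfl, hf⟩ := h
        exact ⟨c • f', map_smul _ _ _, by rw [map_smul, map_smul, hf]⟩
    intro f
    -- Agreement on the span extends to its closure by continuity.
    have hf : toDual σ f ∈ predualSubmodule σ := Subtype.property f
    rw [predualSubmodule, ← SetLike.mem_coe, Submodule.topologicalClosure_coe,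
      mem_closure_iff_seq_limit] at hf
    obtain ⟨u, hu, hlim⟩ := hf
    choose v hvu hv using fun n => hspan (u n) (hu n)
    have hlim' : Tendsto v atTop (𝓝 f) := by
      rw [(toDual σ).isometry.isEmbedding.tendsto_nhds_iff]
      exact hlim.congr fun n => (hvu n).symm
    exact tendsto_nhds_unique (((evaluation σ x).continuous.tendsto f).comp hlim')
      (((F.continuous.tendsto f).comp hlim').congr fun n => (hv n).symm)
  exact ⟨x, ContinuousLinearMap.ext fun f => hx f⟩

instance : WStarAlgebra (HarmonicAlgebra σ) :=
  ⟨Predual σ, inferInstance, inferInstance, inferInstance,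
    -- The involution makes the linear identification conjugate-linear, as `WStarAlgebra` asks.
    ⟨(LinearIsometryEquiv.ofSurjective (evaluation σ) (evaluation_surjective σ)).symm.trans
      (starₗᵢ ℂ)⟩⟩

end HarmonicAlgebra

/-! ### The action of a Markov map on the fixed points of one of its powers -/

section Cyclic

variable {H : Type u} [NormedAddCommGroup H] [InnerProductSpace ℂ H] [CompleteSpace H]
  {A : VonNeumannAlgebra H} (τ : Module.End ℂ A) [IsMarkovMap τ] (k : ℕ)

omit [IsMarkovMap τ] in
lemma apply_mem_harmonic_pow {x : A} (hx : x ∈ harmonicSubmodule (τ ^ k)) :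
    τ x ∈ harmonicSubmodule (τ ^ k) := by
  rw [mem_harmonicSubmodule] at hx ⊢
  rw [← Module.End.mul_apply, ← pow_succ, pow_succ', Module.End.mul_apply, hx]

/-- The restriction of `τ` to the fixed points of `τᵏ`. -/
def harmonicRotation : Module.End ℂ (harmonicSubmodule (τ ^ k)) :=
  τ.restrict fun _ hx => apply_mem_harmonic_pow τ k hx

omit [IsMarkovMap τ] in
lemma coe_harmonicRotation (x : harmonicSubmodule (τ ^ k)) :
    (harmonicRotation τ k x : A) = τ x := rfl

omit [IsMarkovMap τ] in
lemma coe_harmonicRotation_pow (j : ℕ) (x : harmonicSubmodule (τ ^ k)) :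
    ((harmonicRotation τ k ^ j) x : A) = (τ ^ j) x := by
  induction j with
  | zero => rfl
  | succ j ih => rw [pow_succ', pow_succ', Module.End.mul_apply, Module.End.mul_apply,
      coe_harmonicRotation, ih]

lemma harmonicStar_harmonicRotation (x : harmonicSubmodule (τ ^ k)) :
    harmonicStar (τ ^ k) (harmonicRotation τ k x)
      = harmonicRotation τ k (harmonicStar (τ ^ k) x) :=
  Subtype.ext (IsMarkovMap.map_star τ x).symm

omit [IsMarkovMap τ] in
lemma pow_pow_apply_comm (n : ℕ) (a : A) : ((τ ^ k) ^ n) (τ a) = τ (((τ ^ k) ^ n) a) := by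
  rw [← Module.End.mul_apply, ← Module.End.mul_apply, ← pow_mul, ← pow_succ, ← pow_succ']

lemma weakTendsto_pow_apply_mul (x y : harmonicSubmodule (τ ^ k)) :
    WeakTendsto (fun n => ((((τ ^ k) ^ n) (τ (x * y : A)) : A) : H →L[ℂ] H))
      (τ (harmonicMul (τ ^ k) x y) : H →L[ℂ] H) := by
  simp only [pow_pow_apply_comm]
  exact IsNormalMap.weakTendsto (IsMarkovMap.normal (σ := τ)) (weakTendsto_harmonicMul (τ ^ k) x y)
    (fun n => IsMarkovMap.norm_pow_apply_le (τ ^ k) n _)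

/-- The Schwarz inequality for `τ`, carried to the limit along powers of `τ ^ k`. -/
lemma harmonicMul_rotation_le (w : harmonicSubmodule (τ ^ k)) :
    (harmonicMul (τ ^ k) (harmonicStar (τ ^ k) (harmonicRotation τ k w)) (harmonicRotation τ k w) : A)
      ≤ τ (harmonicMul (τ ^ k) (harmonicStar (τ ^ k) w) w) :=
  WeakTendsto.le_of_le (weakTendsto_harmonicMul (τ ^ k) _ _)
    (weakTendsto_pow_apply_mul τ k (harmonicStar (τ ^ k) w) w)
    fun n => IsMarkovMap.map_le_map ((τ ^ k) ^ n) (IsMarkovMap.schwarz (σ := τ) (w : A))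

lemma harmonicMul_rotation_pow_le (j : ℕ) (w : harmonicSubmodule (τ ^ k)) :
    (harmonicMul (τ ^ k) (harmonicStar (τ ^ k) ((harmonicRotation τ k ^ j) w))
      ((harmonicRotation τ k ^ j) w) : A)
      ≤ (τ ^ j) (harmonicMul (τ ^ k) (harmonicStar (τ ^ k) w) w) := by
  induction j with
  | zero => exact le_rfl
  | succ j ih =>
    rw [pow_succ', pow_succ', Module.End.mul_apply, Module.End.mul_apply]
    exact (harmonicMul_rotation_le τ k _).trans (IsMarkovMap.map_le_map τ ih)

variable {k}

/-- Write `q(w) = w⋆ ∘ w` and `k = j + 1`. Since `τʲ⁺¹` is the identity on fixed points, `q(w) ≤ τʲ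
q(τ w) ≤ τʲ⁺¹ q(w) = q(w)`. Equality holds throughout, and the injective `τʲ` can be removed. -/
lemma apply_harmonicMul_star_self (hk : 1 ≤ k) (w : harmonicSubmodule (τ ^ k)) :
    harmonicRotation τ k (harmonicMul (τ ^ k) (harmonicStar (τ ^ k) w) w) =
      harmonicMul (τ ^ k) (harmonicStar (τ ^ k) (harmonicRotation τ k w)) (harmonicRotation τ k w)
      := by
  obtain ⟨j, rfl⟩ : ∃ j, k = j + 1 := ⟨k - 1, by omega⟩
  set R := harmonicRotation τ (j + 1) with hR
  set q := fun w => harmonicMul (τ ^ (j + 1)) (harmonicStar (τ ^ (j + 1)) w) w with hq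
  have hRj : ∀ v, (R ^ j) (R v) = v := fun v => Subtype.ext (by
    rw [hR, coe_harmonicRotation_pow, coe_harmonicRotation, ← Module.End.mul_apply, ← pow_succ]
    exact v.2)
  have h1 : (q w : A) ≤ (τ ^ j) (q (R w)) := by
    have := harmonicMul_rotation_pow_le τ (j + 1) j (R w)
    rw [← hR, hRj] at this
    exact this
  have h2 : (τ ^ j) (q (R w) : A) ≤ q w := by
    have h3 := IsMarkovMap.map_le_map (τ ^ j) (harmonicMul_rotation_le τ (j + 1) w)
    rw [← Module.End.mul_apply, ← pow_succ] at h3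
    exact h3.trans (Subtype.property (q w)).le
  have h4 : (R ^ j) (q (R w)) = (R ^ j) (R (q w)) := by
    rw [hRj]
    exact Subtype.ext ((coe_harmonicRotation_pow τ (j + 1) j _).trans (le_antisymm h2 h1))
  have hcomm : ∀ v, R ((R ^ j) v) = v := fun v => by
    have := congrArg (fun T : Module.End ℂ _ => T v) ((Commute.refl R).pow_right j).eq
    exact this.trans (hRj v)
  have h5 := congrArg R h4
  rw [hcomm, hcomm] at h5
  exact h5.symm

lemma harmonicRotation_harmonicMul (hk : 1 ≤ k) (x y : harmonicSubmodule (τ ^ k)) :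
    harmonicRotation τ k (harmonicMul (τ ^ k) x y) =
      harmonicMul (τ ^ k) (harmonicRotation τ k x) (harmonicRotation τ k y) := by
  set R := harmonicRotation τ k with hR
  set m := harmonicMulBilin (τ ^ k) with hm
  have hadd : ∀ x x', harmonicStar (τ ^ k) (x + x') = harmonicStar (τ ^ k) x
      + harmonicStar (τ ^ k) x' := fun _ _ => Subtype.ext (star_add _ _)
  have hsmul : ∀ (c : ℂ) x, harmonicStar (τ ^ k) (c • x)
      = starRingEnd ℂ c • harmonicStar (τ ^ k) x := fun _ _ => Subtype.ext (star_smul _ _)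
  let B : harmonicSubmodule (τ ^ k) →ₗ⋆[ℂ] harmonicSubmodule (τ ^ k) →ₗ[ℂ]
      harmonicSubmodule (τ ^ k) := LinearMap.mk₂'ₛₗ (starRingEnd ℂ) (RingHom.id ℂ)
    (fun x y => R (m (harmonicStar (τ ^ k) x) y) - m (harmonicStar (τ ^ k) (R x)) (R y))
    (fun x x' y => by simp only [map_add, hadd, LinearMap.add_apply]; abel)
    (fun c x y => by simp only [map_smul, hsmul, LinearMap.smul_apply, smul_sub])
    (fun x y y' => by simp only [map_add]; abel)
    (fun c x y => by simp only [map_smul, smul_sub, RingHom.id_apply])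
  have h := sesquilinear_mem_of_diagonal B ⊥
    (fun w => sub_eq_zero.2 (apply_harmonicMul_star_self τ hk w)) (harmonicStar (τ ^ k) x) y
  have e : ∀ z, harmonicStar (τ ^ k) (harmonicStar (τ ^ k) z) = z :=
    fun z => Subtype.ext (star_star _)
  have h' : R (m (harmonicStar (τ ^ k) (harmonicStar (τ ^ k) x)) y)
    - m (harmonicStar (τ ^ k) (R (harmonicStar (τ ^ k) x))) (R y) = 0 := h
  rw [← harmonicStar_harmonicRotation, e, e, sub_eq_zero] at h'
  exact h'

lemma tendsto_atTop_of_residues {α : Type*} {f : ℕ → α} {l : Filter α} (hk : 1 ≤ k)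
    (h : ∀ r < k, Tendsto (fun n => f (k * n + r)) atTop l) : Tendsto f atTop l := by
  intro s hs
  have h1 : ∀ᶠ n in atTop, ∀ r ∈ Finset.range k, f (k * n + r) ∈ s :=
    (Finset.range k).eventually_all.2 fun r hr => h r (Finset.mem_range.1 hr) hs
  have h2 : Tendsto (fun n => n / k) atTop atTop := Nat.tendsto_div_const_atTop (by omega)
  refine (h2.eventually h1).mono fun n hn => ?_
  have := hn (n % k) (Finset.mem_range.2 (Nat.mod_lt _ hk))
  rwa [Nat.div_add_mod] at this

/-- Along the residue class of `r` modulo `k` the limit is `τʳ b = b`, by normality of `τ ^ r`. -/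
lemma weakTendsto_pow_of_pow_pow {a : A} {b : A} (hk : 1 ≤ k)
    (h : WeakTendsto (fun n => ((((τ ^ k) ^ n) a : A) : H →L[ℂ] H)) (b : H →L[ℂ] H))
    (hb : τ b = b) : WeakTendsto (fun n => (((τ ^ n) a : A) : H →L[ℂ] H)) (b : H →L[ℂ] H) := by
  intro ξ η
  refine tendsto_atTop_of_residues hk fun r _ => ?_
  have h1 := IsNormalMap.weakTendsto (IsMarkovMap.normal (σ := τ ^ r)) h
    (fun n => IsMarkovMap.norm_pow_apply_le (τ ^ k) n a) ξ η
  have hb' : (τ ^ r) b = b := pow_apply_of_mem_harmonic hb r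
  rw [hb'] at h1
  refine h1.congr fun n => ?_
  dsimp only
  rw [← Module.End.mul_apply, ← pow_mul, ← pow_add, add_comm]

/-- The Choi-Effros product of eigenvectors. -/
lemma tendsto_eigenvector_mul (hk : 1 ≤ k) {x y : harmonicSubmodule (τ ^ k)} {c d : Circle}
    (hx : τ x = (c : ℂ) • (x : A)) (hy : τ y = (d : ℂ) • (y : A)) (ξ : H) :
    Tendsto (fun n : ℕ =>
        (((((c : ℂ) * (d : ℂ)) ^ n)⁻¹ • (τ ^ n) (x * y : A) : A) : H →L[ℂ] H) ξ)
      atTop (𝓝 (((harmonicMul (τ ^ k) x y : A) : H →L[ℂ] H) ξ)) := by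
  set z := harmonicMul (τ ^ k) x y with hz
  have hcd : (c : ℂ) * (d : ℂ) ≠ 0 := mul_ne_zero c.coe_ne_zero d.coe_ne_zero
  have hnorm : ‖(c : ℂ) * (d : ℂ)‖ = 1 := by
    rw [norm_mul, Circle.norm_coe, Circle.norm_coe, one_mul]
  -- Multiplicativity of `τ` makes the product an eigenvector for `c d`; only the defect `p` remains
  -- to be controlled.
  have hτz : τ z = ((c : ℂ) * (d : ℂ)) • (z : A) := by
    have h1 : harmonicRotation τ k x = (c : ℂ) • x := Subtype.ext hx
    have h2 : harmonicRotation τ k y = (d : ℂ) • y := Subtype.ext hy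
    have h3 := harmonicRotation_harmonicMul τ hk x y
    rw [h1, h2] at h3
    have h4 : harmonicMul (τ ^ k) ((c : ℂ) • x) ((d : ℂ) • y) = ((c : ℂ) * (d : ℂ)) • z := by
      change harmonicMulBilin (τ ^ k) ((c : ℂ) • x) ((d : ℂ) • y) = _
      rw [map_smul, LinearMap.map_smul₂, smul_smul, mul_comm]
      rfl
    rw [h4] at h3
    exact congrArg Subtype.val h3
  have hτz' : ∀ n : ℕ, (((c : ℂ) * (d : ℂ)) ^ n)⁻¹ • (τ ^ n) (z : A) = z := fun n => by
    induction n with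
    | zero => simp
    | succ n ih =>
      rw [pow_succ τ, Module.End.mul_apply, hτz, map_smul, smul_smul, pow_succ, mul_inv, mul_assoc,
        inv_mul_cancel₀ hcd, mul_one, ih]
  set p : A := (x : A) * (y : A) - z with hp
  have hpnull : WeakTendsto (fun n => (((τ ^ n) (star p * p) : A) : H →L[ℂ] H)) 0 := by
    refine weakTendsto_pow_of_pow_pow τ hk (b := 0) ?_ (map_zero τ)
    -- The null space controls `a a⋆`; the adjoint pair is used to obtain `p⋆ p`.
    have h1 := harmonicMul_sub_mul_mem_weakNullSubmodule (τ ^ k) (harmonicStar (τ ^ k) y)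
      (harmonicStar (τ ^ k) x)
    rw [← harmonicStar_harmonicMul, ← hz] at h1
    have h2 : (harmonicStar (τ ^ k) z : A) - (harmonicStar (τ ^ k) y : A) * harmonicStar (τ ^ k) x
        = -star p := by
      simp [hp, harmonicStar]
    rw [h2] at h1
    have h3 : WeakTendsto (fun n => ((((τ ^ k) ^ n) (-star p * star (-star p)) : A) :
      H →L[ℂ] H)) 0 := h1
    simpa using h3
  have h0 : Tendsto (fun n => (((((c : ℂ) * (d : ℂ)) ^ n)⁻¹ • (τ ^ n) p : A) : H →L[ℂ] H) ξ) atTop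
      (𝓝 0) := by
    have h1 : Tendsto (fun n => (((τ ^ n) p : A) : H →L[ℂ] H) ξ) atTop (𝓝 0) := by
      refine tendsto_zero_of_weakTendsto_star_mul ?_ ξ
      exact WeakTendsto.zero_of_le (fun n => star_mul_self_nonneg _)
        (fun n => IsMarkovMap.schwarz (σ := τ ^ n) p) hpnull
    refine squeeze_zero_norm (fun n => le_of_eq ?_) (by simpa using h1.norm)
    rw [show (((((c : ℂ) * (d : ℂ)) ^ n)⁻¹ • (τ ^ n) p : A) : H →L[ℂ] H) ξ
      = (((c : ℂ) * (d : ℂ)) ^ n)⁻¹ • (((τ ^ n) p : A) : H →L[ℂ] H) ξ from rfl, norm_smul, norm_inv,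
      norm_pow, hnorm, one_pow, inv_one, one_mul]
  have h2 := h0.add_const (((z : A) : H →L[ℂ] H) ξ)
  rw [zero_add] at h2
  refine h2.congr fun n => ?_
  have e : (((c : ℂ) * (d : ℂ)) ^ n)⁻¹ • (τ ^ n) p + z
      = (((c : ℂ) * (d : ℂ)) ^ n)⁻¹ • (τ ^ n) (x * y : A) := by
    rw [hp, map_sub, smul_sub, hτz' n, sub_add_cancel]
  exact congrArg (fun a : A => (a : H →L[ℂ] H) ξ) e

end Cyclic

/-! ### Eigenvectors for roots of unity -/

section RootsOfUnity

variable {E : Type*} [AddCommGroup E] [Module ℂ E]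

/-- A fixed point of `Tᵏ` is a sum of eigenvectors of `T` for roots of unity. -/
lemma mem_span_eigenvectors_of_pow_apply_eq (T : Module.End ℂ E) {k : ℕ} (hk : 1 ≤ k)
    {G : Subgroup Circle} (hG : ∀ c : Circle, c ^ k = 1 → c ∈ G) {x : E} (hx : (T ^ k) x = x) :
    x ∈ Submodule.span ℂ {y : E | ∃ z ∈ G, T y = (z : ℂ) • y} := by
  have hk0 : k ≠ 0 := by omega
  set ω := Complex.exp (2 * Real.pi * Complex.I / k) with hω
  have hprim : IsPrimitiveRoot ω k := Complex.isPrimitiveRoot_exp k hk0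
  have hω0 : ω ≠ 0 := hprim.ne_zero hk0
  have hnorm : ‖ω‖ = 1 := hprim.norm'_eq_one hk0
  -- The unnormalized Fourier coefficients of the orbit of `x`.
  let y : ℕ → E := fun j => ∑ i ∈ Finset.range k, (ω ^ (j * i))⁻¹ • (T ^ i) x
  have hy : ∀ j, T (y j) = ω ^ j • y j := fun j => by
    have h1 : ∀ i, (ω ^ (j * i))⁻¹ • (T ^ (i + 1)) x
        = ω ^ j • ((ω ^ (j * (i + 1)))⁻¹ • (T ^ (i + 1)) x) := fun i => by
      have e : ω ^ (j * (i + 1)) = ω ^ (j * i) * ω ^ j := by rw [← pow_add]; ring_nf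
      rw [smul_smul, e, mul_inv, mul_left_comm, mul_inv_cancel₀ (pow_ne_zero _ hω0), mul_one]
    have h2 : T (y j) = ω ^ j • ∑ i ∈ Finset.range k,
        (ω ^ (j * (i + 1)))⁻¹ • (T ^ (i + 1)) x := by
      rw [map_sum, Finset.smul_sum]
      refine Finset.sum_congr rfl fun i _ => ?_
      rw [map_smul, ← Module.End.mul_apply, ← pow_succ', h1]
    -- Splitting the sum over `0, …, k` at either end gives invariance under the cyclic shift, since
    -- the end terms agree.
    have h3 := Finset.sum_range_succ (fun i => (ω ^ (j * i))⁻¹ • (T ^ i) x) k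
    have h4 := Finset.sum_range_succ' (fun i => (ω ^ (j * i))⁻¹ • (T ^ i) x) k
    have h5 : (ω ^ (j * k))⁻¹ • (T ^ k) x = (ω ^ (j * 0))⁻¹ • (T ^ 0) x := by
      rw [hx, mul_comm, pow_mul, hprim.pow_eq_one]
      simp
    rw [h2]
    congr 1
    rw [h5, h4] at h3
    exact add_right_cancel h3
  -- Fourier inversion: the geometric sums vanish for `0 < i < k`.
  have hsum : (k : ℂ) • x = ∑ j ∈ Finset.range k, y j := by
    rw [Finset.sum_comm]
    have h1 : ∀ i ∈ Finset.range k, ∑ j ∈ Finset.range k, (ω ^ (j * i))⁻¹ • (T ^ i) x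
        = if i = 0 then (k : ℂ) • x else 0 := fun i hi => by
      rw [← Finset.sum_smul]
      split_ifs with h
      · subst h; simp
      · have h2 : ∑ j ∈ Finset.range k, (ω ^ (j * i))⁻¹ = 0 := by
          have hne : (ω ^ i)⁻¹ ≠ 1 := by
            rw [Ne, inv_eq_one]
            exact hprim.pow_ne_one_of_pos_of_lt h (Finset.mem_range.1 hi)
          have h3 := mul_neg_geom_sum (ω ^ i)⁻¹ k
          rw [inv_pow, ← pow_mul, mul_comm i k, pow_mul, hprim.pow_eq_one, one_pow,
            inv_one, sub_self] at h3
          have h4 := (mul_eq_zero.1 h3).resolve_left (sub_ne_zero.2 hne.symm)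
          rw [← h4]
          refine Finset.sum_congr rfl fun j _ => ?_
          rw [inv_pow, ← pow_mul, mul_comm]
        rw [h2, zero_smul]
    rw [Finset.sum_congr rfl h1, Finset.sum_ite_eq' , if_pos (Finset.mem_range.2 hk)]
  have hmem : ∀ j, y j ∈ Submodule.span ℂ {y : E | ∃ z ∈ G, T y = (z : ℂ) • y} := fun j => by
    refine Submodule.subset_span ⟨⟨ω ^ j, by simp [Submonoid.unitSphere, hnorm]⟩, hG _ ?_, hy j⟩
    refine Subtype.ext ?_
    change (ω ^ j) ^ k = 1
    rw [← pow_mul, mul_comm, pow_mul, hprim.pow_eq_one, one_pow]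
  rw [← inv_smul_smul₀ (Nat.cast_ne_zero.2 hk0 : (k : ℂ) ≠ 0) x, hsum]
  exact Submodule.smul_mem _ _ (Submodule.sum_mem _ fun j _ => hmem j)

end RootsOfUnity

/-! ### Peripheral spaces as fixed-point spaces of a power. -/

section PeripheralSpace

variable {H : Type u} [NormedAddCommGroup H] [InnerProductSpace ℂ H] [CompleteSpace H]
  {A : VonNeumannAlgebra H}

/-- Stated for any continuous linear map so that it applies to the dilation `θ` as well as to `τ`.
-/
lemma peripheralSpace_eq_harmonicSubmodule (T : Module.End ℂ A) (hT : Continuous T) {k : ℕ}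
    (hk : 1 ≤ k) {G : Subgroup Circle} (hG : ∀ c : Circle, c ^ k = 1 → c ∈ G)
    (hspec : ∀ c ∈ G, ∀ x : A, x ≠ 0 → T x = (c : ℂ) • x → c ^ k = 1) :
    peripheralSpace T G = harmonicSubmodule (T ^ k) := by
  refine le_antisymm (Submodule.topologicalClosure_minimal _ (Submodule.span_le.2 ?_) ?_)
    fun x hx => Submodule.le_topologicalClosure _ (mem_span_eigenvectors_of_pow_apply_eq T hk hG hx)
  · rintro x ⟨c, hc, hx⟩
    rw [SetLike.mem_coe, mem_harmonicSubmodule]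
    have h1 : ∀ n : ℕ, (T ^ n) x = ((c ^ n : Circle) : ℂ) • x := fun n => by
      induction n with
      | zero => simp
      | succ n ih => rw [pow_succ', Module.End.mul_apply, ih, map_smul, hx, smul_smul, pow_succ,
          Circle.coe_mul]
    rw [h1]
    by_cases h0 : x = 0
    · rw [h0, smul_zero]
    · rw [hspec c hc x h0 hx, Circle.coe_one, one_smul]
  · refine isClosed_eq ?_ continuous_id
    rw [Module.End.coe_pow]
    exact hT.iterate k

end PeripheralSpace

/-! ### Fixed points and the minimal dilation -/

section MinimalDilation

variable {H : Type u} [NormedAddCommGroup H] [InnerProductSpace ℂ H] [CompleteSpace H]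
  {K : Type u} [NormedAddCommGroup K] [InnerProductSpace ℂ K] [CompleteSpace K]

lemma inner_compress (V : H →ₗᵢ[ℂ] K) (z : K →L[ℂ] K) (h h' : H) :
    inner ℂ h (compress V z h') = inner ℂ (V h) (z (V h')) := by
  simp [compress, ContinuousLinearMap.adjoint_inner_right]

lemma compress_sub (V : H →ₗᵢ[ℂ] K) (y z : K →L[ℂ] K) :
    compress V (y - z) = compress V y - compress V z := by
  ext h
  simp [compress]

lemma compress_smul (V : H →ₗᵢ[ℂ] K) (c : ℂ) (z : K →L[ℂ] K) :
    compress V (c • z) = c • compress V z := by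
  ext h
  simp [compress]

lemma adjoint_isometry_apply (V : H →ₗᵢ[ℂ] K) (h : H) :
    ContinuousLinearMap.adjoint V.toContinuousLinearMap (V h) = h := by
  refine ext_inner_left ℂ fun h' => ?_
  rw [ContinuousLinearMap.adjoint_inner_right]
  exact V.inner_map_map h' h

lemma inflate_apply (V : H →ₗᵢ[ℂ] K) (x : H →L[ℂ] H) (h : H) : inflate V x (V h) = V (x h) := by
  simp [inflate, adjoint_isometry_apply]

lemma inflate_mul (V : H →ₗᵢ[ℂ] K) (x y : H →L[ℂ] H) :
    inflate V (x * y) = inflate V x * inflate V y := by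
  ext v
  simp [inflate, adjoint_isometry_apply]

lemma inflate_star (V : H →ₗᵢ[ℂ] K) (x : H →L[ℂ] H) : star (inflate V x) = inflate V (star x) := by
  refine ContinuousLinearMap.ext fun v => ext_inner_left ℂ fun w => ?_
  simp [inflate, ContinuousLinearMap.star_eq_adjoint, ContinuousLinearMap.adjoint_comp,
    ContinuousLinearMap.comp_assoc]

lemma inflate_compress (V : H →ₗᵢ[ℂ] K) (z : K →L[ℂ] K) :
    inflate V (compress V z) = inflate V 1 * z * inflate V 1 := by
  ext v
  simp [inflate, compress]

lemma inner_star_apply (z : K →L[ℂ] K) (v w : K) : inner ℂ (star z v) w = inner ℂ v (z w) := by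
  rw [ContinuousLinearMap.star_eq_adjoint, ContinuousLinearMap.adjoint_inner_left]

lemma iterate_map_star_of_starAlgHom {B : VonNeumannAlgebra K} (θ : B →⋆ₐ[ℂ] B) (n : ℕ) (z : B) :
    θ^[n] (star z) = star (θ^[n] z) := by
  induction n with
  | zero => rfl
  | succ n ih => rw [Function.iterate_succ_apply', Function.iterate_succ_apply', ih, map_star]

lemma norm_iterate_apply_le {B : VonNeumannAlgebra K} (θ : B →⋆ₐ[ℂ] B) (n : ℕ) (z : B) :
    ‖θ^[n] z‖ ≤ ‖z‖ := by
  induction n with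
  | zero => exact le_rfl
  | succ n ih =>
    rw [Function.iterate_succ_apply']
    exact (NonUnitalStarAlgHom.norm_apply_le θ _).trans ih

namespace IsMinimalDilation

variable {A : VonNeumannAlgebra H} {τ : Module.End ℂ A} [IsMarkovMap τ] {V : H →ₗᵢ[ℂ] K}
  {B : VonNeumannAlgebra K} {θ : B →⋆ₐ[ℂ] B} (hd : IsMinimalDilation τ V B θ)

/-- The inclusion of `A` in `B`. -/
def embed (x : A) : B := ⟨inflate V (x : H →L[ℂ] H), hd.inflate_mem x⟩

/-- The projections `θⁿ(p)`. -/
def proj (n : ℕ) : B := θ^[n] (hd.embed 1)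

/-- The compression of `B` onto `A`. -/
def compr (z : B) : A := ⟨compress V (z : K →L[ℂ] K), hd.compress_mem z⟩

omit [IsMarkovMap τ] in
lemma embed_mul (x y : A) : hd.embed (x * y) = hd.embed x * hd.embed y :=
  Subtype.ext (inflate_mul V _ _)

omit [IsMarkovMap τ] in
lemma embed_compr (z : B) : hd.embed (hd.compr z) = hd.embed 1 * z * hd.embed 1 :=
  Subtype.ext (inflate_compress V _)

omit [IsMarkovMap τ] in
lemma star_proj (n : ℕ) : star (hd.proj n) = hd.proj n := by
  rw [proj, ← iterate_map_star_of_starAlgHom]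
  congr 1
  exact Subtype.ext ((inflate_star V _).trans (by simp [embed]))

omit [IsMarkovMap τ] in
lemma proj_mul_self (n : ℕ) : hd.proj n * hd.proj n = hd.proj n := by
  rw [proj, ← iterate_map_mul, ← hd.embed_mul, one_mul]

omit [IsMarkovMap τ] in
lemma proj_inner (n : ℕ) (v w : K) :
    inner ℂ ((hd.proj n : K →L[ℂ] K) v) w = inner ℂ v ((hd.proj n : K →L[ℂ] K) w) := by
  rw [← inner_star_apply, ← StarMemClass.coe_star, hd.star_proj]

omit [IsMarkovMap τ] in
lemma norm_proj_le (n : ℕ) : ‖(hd.proj n : K →L[ℂ] K)‖ ≤ 1 := by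
  have h : ‖hd.proj n‖ * ‖hd.proj n‖ = ‖hd.proj n‖ := by
    rw [← CStarRing.norm_star_mul_self, hd.star_proj, hd.proj_mul_self]
  change ‖hd.proj n‖ ≤ 1
  rcases (norm_nonneg (hd.proj n)).eq_or_lt with h0 | h0
  · rw [← h0]; exact zero_le_one
  · exact (mul_left_cancel₀ h0.ne' (h.trans (mul_one _).symm)).le

/-- As `τⁿ(1) = 1`, the projection `θⁿ(p)` preserves the norm of vectors in `H`, hence fixes them.
-/
lemma proj_apply (n : ℕ) (h : H) : (hd.proj n : K →L[ℂ] K) (V h) = V h := by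
  have h1 : inner ℂ (V h) ((hd.proj n : K →L[ℂ] K) (V h)) = inner ℂ h h := by
    rw [← inner_compress]
    have := hd.dilation n 1
    rw [IsMarkovMap.map_one (σ := τ ^ n)] at this
    exact congrArg (fun T : H →L[ℂ] H => inner ℂ h (T h)) this
  have h2 : inner ℂ ((hd.proj n : K →L[ℂ] K) (V h)) ((hd.proj n : K →L[ℂ] K) (V h))
      = inner ℂ h h := by
    rw [hd.proj_inner]
    exact (congrArg (fun T : B => inner ℂ (V h) ((T : K →L[ℂ] K) (V h)))
      (hd.proj_mul_self n)).trans h1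
  rw [← sub_eq_zero, ← inner_self_eq_zero (𝕜 := ℂ), inner_sub_left, inner_sub_right,
    inner_sub_right, h2, hd.proj_inner, h1, V.inner_map_map, sub_self]

/-- Apply `θᵐ` to `θˡ(p) p = p`. -/
lemma proj_mul_proj {m n : ℕ} (hmn : m ≤ n) : hd.proj n * hd.proj m = hd.proj m := by
  obtain ⟨l, rfl⟩ := Nat.exists_eq_add_of_le hmn
  have h1 : hd.proj l * hd.embed 1 = hd.embed 1 := by
    refine Subtype.ext (ContinuousLinearMap.ext fun v => ?_)
    exact hd.proj_apply l _
  rw [proj, proj, Function.iterate_add_apply, ← iterate_map_mul]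
  exact congrArg _ h1

lemma proj_apply_dilationWord (x : ℕ → A) (h : H) {m n : ℕ} (hmn : m ≤ n) :
    (hd.proj n : K →L[ℂ] K) (dilationWord V hd.embed θ x h m) = dilationWord V hd.embed θ x h m := by
  cases m with
  | zero => exact hd.proj_apply n h
  | succ m =>
    have h1 : θ^[m + 1] (hd.embed (x (m + 1)))
        = hd.proj (m + 1) * θ^[m + 1] (hd.embed (x (m + 1))) := by
      rw [proj, ← iterate_map_mul, ← hd.embed_mul, one_mul]
    have h2 : hd.proj n * θ^[m + 1] (hd.embed (x (m + 1))) = θ^[m + 1] (hd.embed (x (m + 1))) := by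
      rw [h1, ← mul_assoc, hd.proj_mul_proj hmn]
    exact congrArg (fun z : B => (z : K →L[ℂ] K) (dilationWord V hd.embed θ x h m)) h2

/-- A dilation word is eventually fixed by the projections; minimality makes the span of words
dense, and the projections are contractions. -/
lemma tendsto_proj (v : K) : Tendsto (fun n => (hd.proj n : K →L[ℂ] K) v) atTop (𝓝 v) := by
  have hv : v ∈ (Submodule.span ℂ {v : K | ∃ (x : ℕ → A) (h : H) (n : ℕ),
      dilationWord V hd.embed θ x h n = v}).topologicalClosure := by
    have := hd.minimal_space
    exact this ▸ Submodule.mem_top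
  have hspan : ∀ w ∈ Submodule.span ℂ {v : K | ∃ (x : ℕ → A) (h : H) (n : ℕ),
      dilationWord V hd.embed θ x h n = v}, ∀ᶠ n in atTop, (hd.proj n : K →L[ℂ] K) w = w := by
    intro w hw
    induction hw using Submodule.span_induction with
    | mem w h =>
      obtain ⟨x, h, m, rfl⟩ := h
      exact (eventually_ge_atTop m).mono fun n hn => hd.proj_apply_dilationWord x h hn
    | zero => simp
    | add w w' _ _ h h' => filter_upwards [h, h'] with n hn hn'; rw [map_add, hn, hn']
    | smul c w _ h => filter_upwards [h] with n hn; rw [map_smul, hn]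
  rw [Metric.tendsto_atTop']
  rw [← SetLike.mem_coe, Submodule.topologicalClosure_coe, Metric.mem_closure_iff] at hv
  intro ε hε
  obtain ⟨w, hw, hvw⟩ := hv (ε / 2) (by positivity)
  obtain ⟨N, hN⟩ := eventually_atTop.1 (hspan w hw)
  refine ⟨N, fun n hn => ?_⟩
  have h1 : ‖(hd.proj n : K →L[ℂ] K) (v - w)‖ ≤ ‖v - w‖ :=
    ((hd.proj n : K →L[ℂ] K).le_opNorm _).trans
      (mul_le_of_le_one_left (norm_nonneg _) (hd.norm_proj_le n))
  rw [map_sub, hN n hn.le] at h1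
  rw [dist_eq_norm] at hvw ⊢
  calc ‖(hd.proj n : K →L[ℂ] K) v - v‖
      = ‖((hd.proj n : K →L[ℂ] K) v - w) - (v - w)‖ := by congr 1; abel
    _ ≤ ‖(hd.proj n : K →L[ℂ] K) v - w‖ + ‖v - w‖ := norm_sub_le _ _
    _ < ε := by linarith

omit [IsMarkovMap τ] in
lemma proj_mul_iterate_mul_proj (n : ℕ) (z : B) :
    hd.proj n * θ^[n] z * hd.proj n = θ^[n] (hd.embed (hd.compr z)) := by
  rw [hd.embed_compr, iterate_map_mul, iterate_map_mul]
  rfl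

/-- The dilation identity extends from `A` to all of `B` because `θⁿ(p)` fixes `H`, so the corner
`θⁿ(p z p)` compresses like `θⁿ(z)`. -/
lemma compr_iterate (n : ℕ) (z : B) : hd.compr (θ^[n] z) = (τ ^ n) (hd.compr z) := by
  refine Subtype.ext ?_
  rw [← hd.dilation n]
  refine ContinuousLinearMap.ext fun h' => ext_inner_left ℂ fun h => ?_
  have h1 := congrArg (fun T : B => inner ℂ (V h) ((T : K →L[ℂ] K) (V h')))
    (hd.proj_mul_iterate_mul_proj n z)
  have h2 : inner ℂ (V h) (((hd.proj n * θ^[n] z * hd.proj n : B) : K →L[ℂ] K) (V h'))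
      = inner ℂ (V h) ((θ^[n] z : K →L[ℂ] K) (V h')) := by
    change inner ℂ (V h) ((hd.proj n : K →L[ℂ] K) ((θ^[n] z : K →L[ℂ] K)
      ((hd.proj n : K →L[ℂ] K) (V h')))) = _
    rw [← hd.proj_inner, hd.proj_apply, hd.proj_apply]
  rw [inner_compress]
  exact (inner_compress V _ h h').trans (h2.symm.trans h1)

omit [IsMarkovMap τ] in
lemma compr_embed (x : A) : hd.compr (hd.embed x) = x := by
  refine Subtype.ext (ContinuousLinearMap.ext fun h' => ext_inner_left ℂ fun h => ?_)
  refine (inner_compress V _ h h').trans ?_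
  exact (congrArg _ (inflate_apply V _ h')).trans (V.inner_map_map h _)

/-- An element that is an eigenvector of infinitely many powers of `θ` is determined by its
compression. -/
lemma eq_zero_of_compr_eq_zero {z : B} {s : ℕ → ℕ} (hs : Tendsto s atTop atTop) {c : ℕ → ℂ}
    (hc : ∀ n, c n ≠ 0) (hz : ∀ n, θ^[s n] z = c n • z) (h0 : hd.compr z = 0) : z = 0 := by
  -- All corners of `z` vanish, and they exhaust `z` as the projections tend to `1`.
  have h1 : ∀ n, hd.proj (s n) * z * hd.proj (s n) = 0 := fun n => by
    have h2 := hd.proj_mul_iterate_mul_proj (s n) z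
    have h3 : hd.embed 0 = 0 := Subtype.ext (by ext v; simp [embed, inflate])
    rw [h0, hz, h3, iterate_map_zero, mul_smul_comm, smul_mul_assoc] at h2
    exact (smul_eq_zero.1 h2).resolve_left (hc n)
  refine Subtype.ext (ContinuousLinearMap.ext fun v => ext_inner_left ℂ fun w => ?_)
  have h2 : Tendsto (fun n => inner ℂ ((hd.proj (s n) : K →L[ℂ] K) w)
      ((z : K →L[ℂ] K) ((hd.proj (s n) : K →L[ℂ] K) v))) atTop (𝓝 (inner ℂ w ((z : K →L[ℂ] K) v))) :=
    ((hd.tendsto_proj w).comp hs).inner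
      (((z : K →L[ℂ] K).continuous.tendsto _).comp ((hd.tendsto_proj v).comp hs))
  refine tendsto_nhds_unique h2 (tendsto_const_nhds.congr fun n => ?_)
  rw [hd.proj_inner]
  exact (congrArg (fun T : B => inner ℂ w ((T : K →L[ℂ] K) v)) (h1 n)).symm

/-- A fixed point of `τᵏ` is the compression of a fixed point of `θᵏ`. -/
lemma exists_compr_eq {k : ℕ} (hk : 1 ≤ k) {x : A} (hx : (τ ^ k) x = x) :
    ∃ z : B, θ^[k] z = z ∧ hd.compr z = x := by
  set u : ℕ → B := fun n => θ^[k * n] (hd.embed x) with hu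
  have hkx : ∀ n, (τ ^ (k * n)) x = x := fun n => by
    rw [pow_mul]
    exact pow_apply_of_mem_harmonic hx n
  have hC : ∀ n, ‖(u n : K →L[ℂ] K)‖ ≤ ‖hd.embed x‖ := fun n => norm_iterate_apply_le θ _ _
  -- The lifts are coherent: cutting a later one by `θ^(k m)(p)` returns the one at level `m`.
  -- Matrix coefficients are therefore Cauchy.
  have hcut : ∀ m n, m ≤ n → hd.proj (k * m) * u n * hd.proj (k * m) = u m := fun m n hmn => by
    obtain ⟨l, rfl⟩ := Nat.exists_eq_add_of_le hmn
    have h1 : u (m + l) = θ^[k * m] (u l) := by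
      simp only [hu, mul_add, Function.iterate_add_apply]
    rw [h1, hd.proj_mul_iterate_mul_proj, hu, hd.compr_iterate, hd.compr_embed, hkx]
  have hkm : Tendsto (fun m => k * m) atTop atTop := tendsto_id.const_mul_atTop' (by omega)
  have hlim : ∀ v w, ∃ l, Tendsto (fun n => inner ℂ v ((u n : K →L[ℂ] K) w)) atTop (𝓝 l) := by
    intro v w
    set C := ‖hd.embed x‖ with hCdef
    set b : ℕ → ℝ := fun m => C * (‖v - (hd.proj (k * m) : K →L[ℂ] K) v‖ * ‖w‖
      + ‖v‖ * ‖w - (hd.proj (k * m) : K →L[ℂ] K) w‖) with hb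
    have hb0 : Tendsto b atTop (𝓝 0) := by
      have h1 : ∀ v, Tendsto (fun m => ‖v - (hd.proj (k * m) : K →L[ℂ] K) v‖) atTop (𝓝 0) :=
        fun v => by
          simpa using ((tendsto_const_nhds (x := v)).sub ((hd.tendsto_proj v).comp hkm)).norm
      simpa using (((h1 v).mul_const ‖w‖).add ((h1 w).const_mul ‖v‖)).const_mul C
    have hdist : ∀ m n, m ≤ n →
        dist (inner ℂ v ((u n : K →L[ℂ] K) w)) (inner ℂ v ((u m : K →L[ℂ] K) w)) ≤ b m := by
      intro m n hmn
      have h1 : inner ℂ v ((u m : K →L[ℂ] K) w) = inner ℂ ((hd.proj (k * m) : K →L[ℂ] K) v)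
          ((u n : K →L[ℂ] K) ((hd.proj (k * m) : K →L[ℂ] K) w)) := by
        rw [hd.proj_inner, ← hcut m n hmn]
        rfl
      have h2 : inner ℂ v ((u n : K →L[ℂ] K) w) - inner ℂ v ((u m : K →L[ℂ] K) w)
          = inner ℂ (v - (hd.proj (k * m) : K →L[ℂ] K) v) ((u n : K →L[ℂ] K) w)
            + inner ℂ ((hd.proj (k * m) : K →L[ℂ] K) v)
              ((u n : K →L[ℂ] K) (w - (hd.proj (k * m) : K →L[ℂ] K) w)) := by
        rw [h1, map_sub, inner_sub_left, inner_sub_right]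
        ring
      have h3 : ‖(hd.proj (k * m) : K →L[ℂ] K) v‖ ≤ ‖v‖ :=
        ((hd.proj (k * m) : K →L[ℂ] K).le_opNorm _).trans
          (mul_le_of_le_one_left (norm_nonneg _) (hd.norm_proj_le _))
      rw [dist_eq_norm, h2, hb]
      dsimp only
      rw [mul_add]
      refine (norm_add_le _ _).trans (add_le_add ?_ ?_)
      · refine (norm_inner_apply_le _ _ _).trans ?_
        gcongr
        exact hC n
      · refine (norm_inner_apply_le _ _ _).trans ?_
        gcongr
        exact hC n
    refine cauchySeq_tendsto_of_complete
      (cauchySeq_of_le_tendsto_0 (fun m => b m + b m) (fun n m N hn hm => ?_) (by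
        simpa using hb0.add hb0))
    exact (dist_triangle_right _ _ _).trans (add_le_add (hdist N n hn) (hdist N m hm))
  obtain ⟨z', hz'⟩ := exists_weak_limit hC hlim
  let z : B := ⟨z', hz'.mem B fun n => Subtype.property _⟩
  have hz : WeakTendsto (fun n => (u n : K →L[ℂ] K)) (z : K →L[ℂ] K) := hz'
  have hnormal : IsNormalMap (θ^[k]) :=
    @Continuous.iterate B (ultraweakTopology B) θ hd.normal k
  refine ⟨z, ?_, ?_⟩
  · have h1 := hnormal.weakTendsto hz hC
    have h2 : ∀ n, θ^[k] (u n) = u (n + 1) := fun n => by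
      simp only [hu]
      rw [mul_add, mul_one, add_comm, Function.iterate_add_apply]
    simp only [h2] at h1
    exact Subtype.ext (h1.unique (hz.comp_tendsto (tendsto_add_atTop_nat 1)))
  · refine Subtype.ext (ContinuousLinearMap.ext fun h' => ext_inner_left ℂ fun h => ?_)
    refine tendsto_nhds_unique ?_ (tendsto_const_nhds (x := inner ℂ h ((x : H →L[ℂ] H) h'))
      (f := (atTop : Filter ℕ)))
    have h1 := hz (V h) (V h')
    rw [← inner_compress] at h1
    refine h1.congr fun n => ?_
    rw [← inner_compress]
    have h2 : hd.compr (u n) = x := by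
      rw [hu, hd.compr_iterate, hd.compr_embed, hkx]
    exact congrArg (fun T : A => inner ℂ h ((T : H →L[ℂ] H) h')) h2

/-- The compression of a product of fixed points of `θᵏ`. -/
lemma weakTendsto_compr_mul {k : ℕ} (hk : 1 ≤ k) {y z : B} (hy : θ^[k] y = y) (hz : θ^[k] z = z) :
    WeakTendsto (fun n => ((((τ ^ k) ^ n) (hd.compr y * hd.compr z) : A) : H →L[ℂ] H))
      (compress V ((y * z : B) : K →L[ℂ] K)) := by
  have hkm : Tendsto (fun m => k * m) atTop atTop := tendsto_id.const_mul_atTop' (by omega)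
  have hfix : ∀ {w : B}, θ^[k] w = w → ∀ n, θ^[k * n] w = w := fun {w} hw n => by
    rw [Function.iterate_mul]
    exact Function.iterate_fixed hw n
  intro h h'
  rw [inner_compress]
  -- Between the factors only `θ^(k n)(p)` remains, since the outer projections fix `H`; it tends
  -- strongly to `1`.
  have h1 : ∀ n, inner ℂ h ((((τ ^ k) ^ n) (hd.compr y * hd.compr z) : H →L[ℂ] H) h')
      = inner ℂ (star (y : K →L[ℂ] K) (V h)) ((hd.proj (k * n) : K →L[ℂ] K)
        ((z : K →L[ℂ] K) (V h'))) := fun n => by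
    have h2 : ((τ ^ k) ^ n) (hd.compr y * hd.compr z)
        = hd.compr (θ^[k * n] (hd.embed (hd.compr y * hd.compr z))) := by
      rw [hd.compr_iterate, hd.compr_embed, pow_mul]
    have h3 : θ^[k * n] (hd.embed (hd.compr y * hd.compr z))
        = hd.proj (k * n) * y * (hd.proj (k * n) * (z * hd.proj (k * n))) := by
      rw [hd.embed_mul, iterate_map_mul, ← hd.proj_mul_iterate_mul_proj,
        ← hd.proj_mul_iterate_mul_proj, hfix hy, hfix hz]
      simp only [mul_assoc]
      rw [← mul_assoc (hd.proj (k * n)) (hd.proj (k * n)), hd.proj_mul_self]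
    rw [h2, h3]
    refine (inner_compress V _ h h').trans ?_
    change inner ℂ (V h) ((hd.proj (k * n) : K →L[ℂ] K) ((y : K →L[ℂ] K)
      ((hd.proj (k * n) : K →L[ℂ] K) ((z : K →L[ℂ] K) ((hd.proj (k * n) : K →L[ℂ] K) (V h')))))) = _
    rw [← hd.proj_inner, hd.proj_apply, hd.proj_apply, inner_star_apply]
  simp only [h1]
  have h2 := (tendsto_const_nhds (x := star (y : K →L[ℂ] K) (V h))
    (f := (atTop : Filter ℕ))).inner (𝕜 := ℂ) ((hd.tendsto_proj ((z : K →L[ℂ] K) (V h'))).comp hkm)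
  rw [inner_star_apply] at h2
  exact h2

end IsMinimalDilation

end MinimalDilation

/-! ### Identification of the boundaries and the Schwarz inequality. -/

section Main

variable {H : Type u} [NormedAddCommGroup H] [InnerProductSpace ℂ H] [CompleteSpace H]
  {A : VonNeumannAlgebra H}

/-- If the eigenvalues of `τ` in `G` are the `k`-th roots of unity, the fixed points of `τᵏ` with
the Choi-Effros product are the Poisson boundary `𝒫_G(τ)`. -/
lemma isPoissonBoundary_incl (τ : Module.End ℂ A) [IsMarkovMap τ] {σ : Module.End ℂ A}
    [IsMarkovMap σ] {k : ℕ} (hk : 1 ≤ k) (hσ : σ = τ ^ k) {G : Subgroup Circle}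
    (hG : ∀ c : Circle, c ^ k = 1 → c ∈ G)
    (hspec : ∀ c ∈ G, ∀ x : A, x ≠ 0 → τ x = (c : ℂ) • x → c ^ k = 1) :
    IsPoissonBoundary τ G (HarmonicAlgebra.incl σ) := by
  subst hσ
  have hτ := peripheralSpace_eq_harmonicSubmodule τ (IsMarkovMap.continuous τ) hk hG hspec
  have hθ : ∀ (K : Type u) [NormedAddCommGroup K] [InnerProductSpace ℂ K] [CompleteSpace K]
      (V : H →ₗᵢ[ℂ] K) (B : VonNeumannAlgebra K) (θ : B →⋆ₐ[ℂ] B), IsMinimalDilation τ V B θ →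
      ∀ z, z ∈ peripheralSpace θ.toAlgHom.toLinearMap G ↔ θ^[k] z = z := by
    intro K _ _ _ V B θ hd z
    rw [peripheralSpace_eq_harmonicSubmodule θ.toAlgHom.toLinearMap
      (AddMonoidHomClass.continuous_of_bound θ 1 fun z => by
        simpa using NonUnitalStarAlgHom.norm_apply_le θ z) hk hG, mem_harmonicSubmodule,
      Module.End.pow_apply]
    · rfl
    · intro c hc z hz hcz
      have hcz' : ∀ n : ℕ, θ^[n] z = ((c : ℂ) ^ n) • z := fun n => by
        induction n with
        | zero => simp
        | succ n ih =>
          rw [Function.iterate_succ_apply', ih, map_smul, show θ z = (c : ℂ) • z from hcz,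
            smul_smul, pow_succ]
      -- The spectral condition passes to `θ`: an eigenvector has nonzero compression, which is an
      -- eigenvector of `τ` for the same `c`.
      refine hspec c hc (hd.compr z) (fun h0 => hz ?_) ?_
      · exact hd.eq_zero_of_compr_eq_zero tendsto_id
          (fun n => pow_ne_zero n c.coe_ne_zero) hcz' h0
      · have h1 := hd.compr_iterate 1 z
        rw [hcz', pow_one, pow_one] at h1
        rw [← h1]
        exact Subtype.ext (compress_smul V _ _)
  refine ⟨(HarmonicAlgebra.range_incl _).trans hτ.symm, HarmonicAlgebra.incl_one _,
    HarmonicAlgebra.incl_star _, ?_, ?_, ?_⟩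
  · intro K _ _ _ V B θ hd
    refine ⟨fun z hz => ?_, fun y hy z hz hyz => ?_, ?_⟩
    · rw [SetLike.mem_coe, hθ K V B θ hd] at hz
      refine ⟨hd.compr z, ?_, rfl⟩
      rw [hτ, SetLike.mem_coe, mem_harmonicSubmodule, ← hd.compr_iterate, hz]
    · rw [SetLike.mem_coe, hθ K V B θ hd] at hy hz
      rw [← sub_eq_zero]
      have hfix : ∀ {w : B}, θ^[k] w = w → ∀ n, θ^[k * n] w = w := fun {w} hw n => by
        rw [Function.iterate_mul]
        exact Function.iterate_fixed hw n
      refine hd.eq_zero_of_compr_eq_zero (s := fun n => k * n)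
        (tendsto_id.const_mul_atTop' (by omega)) (c := fun _ => 1)
        (fun _ => one_ne_zero) (fun n => ?_) ?_
      · rw [iterate_map_sub, hfix hy, hfix hz, one_smul]
      · refine Subtype.ext ((compress_sub V _ _).trans ?_)
        exact sub_eq_zero.2 hyz
    · rintro _ ⟨x, hx, rfl⟩
      rw [hτ, SetLike.mem_coe, mem_harmonicSubmodule] at hx
      obtain ⟨z, hz, rfl⟩ := hd.exists_compr_eq hk hx
      exact ⟨z, (hθ K V B θ hd z).2 hz, rfl⟩
  · intro K _ _ _ V B θ hd a b y hy z hz hya hzb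
    rw [hθ K V B θ hd] at hy hz
    have h1 := hd.weakTendsto_compr_mul hk hy hz
    have hya' : hd.compr y = HarmonicAlgebra.incl _ a := Subtype.ext hya
    have hzb' : hd.compr z = HarmonicAlgebra.incl _ b := Subtype.ext hzb
    rw [hya', hzb'] at h1
    exact (HarmonicAlgebra.weakTendsto_incl_mul _ a b).unique h1
  · intro a b c _ d _ ha hb h
    exact tendsto_eigenvector_mul τ hk ha hb h

lemma exists_eq_star_mul_self {C : Type*} [NonUnitalCStarAlgebra C] [PartialOrder C]
    [StarOrderedRing C] {a : C} (ha : 0 ≤ a) : ∃ b, a = star b * b :=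
  CStarAlgebra.nonneg_iff_eq_star_mul_self.1 ha

/-- The Kadison-Schwarz inequality. -/
lemma CompletelyPositiveMap.star_mul_self_le (τ : CompletelyPositiveMap A A) (hunital : τ 1 = 1)
    (x : A) : star (τ x) * τ x ≤ τ (star x * x) := by
  -- Here `S⋆ S` has rows `(x⋆ x, x⋆)` and `(x, 1)`.
  let S : CStarMatrix (Fin 2) (Fin 2) A := CStarMatrix.ofMatrix !![x, 1; 0, 0]
  have h1 : 0 ≤ (star S * S).map τ := τ.map_cstarMatrix_nonneg _ (star_mul_self_nonneg S)
  obtain ⟨N, hN⟩ := exists_eq_star_mul_self h1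
  have hent : ∀ i j, ∑ l, star (N l i) * N l j = τ (∑ l, star (S l i) * S l j) := fun i j => by
    have := congrArg (fun M : CStarMatrix (Fin 2) (Fin 2) A => M i j) hN
    simpa [CStarMatrix.mul_apply, CStarMatrix.star_apply] using this.symm
  have h00 := hent 0 0
  have h01 := hent 0 1
  have h10 := hent 1 0
  have h11 := hent 1 1
  simp [S, Fin.sum_univ_two, hunital] at h00 h01 h10 h11
  have hstar : τ (star x) = star (τ x) := by
    rw [← h01, ← h10]
    simp
  -- Evaluate the positive matrix `N⋆ N` on the column `(1, -τ x)`; unitality leaves the Schur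
  -- complement.
  have key : τ (star x * x) - star (τ x) * τ x
      = star (N 0 0 - N 0 1 * τ x) * (N 0 0 - N 0 1 * τ x)
        + star (N 1 0 - N 1 1 * τ x) * (N 1 0 - N 1 1 * τ x) := by
    have e : star (N 0 0 - N 0 1 * τ x) * (N 0 0 - N 0 1 * τ x)
        + star (N 1 0 - N 1 1 * τ x) * (N 1 0 - N 1 1 * τ x)
        = (star (N 0 0) * N 0 0 + star (N 1 0) * N 1 0)
          - (star (N 0 0) * N 0 1 + star (N 1 0) * N 1 1) * τ x
          - star (τ x) * (star (N 0 1) * N 0 0 + star (N 1 1) * N 1 0)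
          + star (τ x) * (star (N 0 1) * N 0 1 + star (N 1 1) * N 1 1) * τ x := by
      simp only [star_sub, star_mul]
      noncomm_ring
    rw [e, h00, h01, h10, h11, hstar]
    noncomm_ring
  rw [← sub_nonneg, key]
  exact add_nonneg (star_mul_self_nonneg _) (star_mul_self_nonneg _)

end Main

end

theorem corollary4p4 {H : Type u} [NormedAddCommGroup H] [InnerProductSpace ℂ H] [CompleteSpace H]
    (A : VonNeumannAlgebra H) (τ : CompletelyPositiveMap A A) (hunital : τ 1 = 1)
    (hnormal : IsNormalMap τ)
    (hfin : (Subgroup.closure (peripheralPointSpectrum τ.toLinearMap) : Set Circle).Finite) :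
    ∃ k : ℕ, 1 ≤ k ∧
      (peripheralSpace τ.toLinearMap ⊤ : Set A) = {x : A | τ^[k] x = x} ∧
      ∃ (M : Type u) (_ : CStarAlgebra M) (φ : M →ₗᵢ[ℂ] A),
        IsPoissonBoundary (τ.toLinearMap : Module.End ℂ A) ⊤ φ ∧
        IsPoissonBoundary ((τ.toLinearMap : Module.End ℂ A) ^ k) ⊥ φ ∧
        WStarAlgebra M := by
  set T : Module.End ℂ A := τ.toLinearMap with hT
  have hmarkov : IsMarkovMap T := ⟨hunital, τ.star_mul_self_le hunital, hnormal⟩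
  set S := Subgroup.closure (peripheralPointSpectrum T) with hS
  have : Finite S := hfin
  have hk : 1 ≤ Nat.card S := Nat.card_pos
  -- Lagrange's theorem in the finite group `S`, with `k` its order.
  have hspec : ∀ c ∈ (⊤ : Subgroup Circle), ∀ x : A, x ≠ 0 → T x = (c : ℂ) • x →
      c ^ Nat.card S = 1 := fun c _ x hx hcx => by
    have hc : c ∈ S := Subgroup.subset_closure
      (Module.End.hasEigenvalue_of_hasEigenvector ⟨Module.End.mem_eigenspace_iff.2 hcx, hx⟩)
    exact congrArg Subtype.val (pow_card_eq_one' (x := (⟨c, hc⟩ : S)))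
  refine ⟨Nat.card S, hk, ?_, HarmonicAlgebra (T ^ Nat.card S), inferInstance,
    HarmonicAlgebra.incl _, ?_, ?_, inferInstance⟩
  · rw [peripheralSpace_eq_harmonicSubmodule T (IsMarkovMap.continuous T) hk
      (fun c _ => Subgroup.mem_top c) hspec]
    ext x
    rw [SetLike.mem_coe, mem_harmonicSubmodule, Module.End.pow_apply]
    rfl
  · exact isPoissonBoundary_incl T hk rfl (fun c _ => Subgroup.mem_top c) hspec
  -- Exponent `1`: the trivial group consists of the first roots of unity.
  · exact isPoissonBoundary_incl (T ^ Nat.card S) le_rfl (pow_one _).symm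
      (fun c hc => by rwa [pow_one] at hc) fun c hc _ _ _ => by rwa [pow_one]
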